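/- **Theorem (convergence rate of SAPS-PSGD).** Let $n\ge 2$ workers train models in $\mathbb R^N$. Worker $i$ has a data distribution $\mathcal D_i$ and a loss $F_i(\mathbf x;\xi)$. Put $f_i(\mathbf x)=\mathbb E_{\xi\sim\mathcal D_i}F_i(\mathbf x;\xi)$, $f=\frac1n\sum_{i=1}^n f_i$, and let $f^*=\inf f$ be finite. For $X=[\mathbf x^{(1)},\dots,\mathbf x^{(n)}]\in\mathbb R^{N\times n}$ write $\overline X=X\frac{\mathbf 1_n}{n}$ and $G(X;\xi)=[\nabla F_1(\mathbf x^{(1)};\xi^{(1)}),\dots,\nabla F_n(\mathbf x^{(n)};\xi^{(n)})]$. Starting from a deterministic $X_0$, SAPS-PSGD with constant step size $\gamma$ computes $$X_{t+1}=X_t\circ\lnot M_t+(X_t\circ M_t)\,W_t-\gamma\,G(X_t;\xi_t),\qquad t\ge 0,$$ where $\circ$ is the entrywise product, all columns of $M_t$ equal one random mask vector $\mathbf m_t\in\{0,1\}^N$, $\lnot M_t$ is the complementary mask, $W_t\in\mathbb R^{n\times n}$ is a random gossip matrix and $\xi_t^{(i)}\sim\mathcal D_i$. All the $W_t$, all the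 entries $\mathbf m_t^{[j]}$ and all the samples $\xi_t^{(i)}$ are mutually independent. Assume: 1. every $f_i$ is differentiable and $\nabla f_i$ is $L$-Lipschitz; 2. the $W_t$ are identically distributed and doubly stochastic; 3. the second largest eigenvalue $\rho$ (with multiplicity) of $\mathbb E(W_tW_t^{\top})$ satisfies $\rho<1$ (for symmetric gossip matrices this is the matrix $\mathbb E(W_t^{\top}W_t)$); 4. $\mathbf m_t^{[j]}=1$ with probability $p=1/c$ and $0$ with probability $q=1-1/c$, where $c\ge 1$; 5. stochastic gradients are unbiased, $\mathbb E_{\xi\sim\mathcal D_i}\nabla F_i(\mathbf x;\xi)=\nabla f_i(\mathbf x)$, and for some $\sigma>0$, $\zeta\ge 0$ and all $i,\mathbf x$, $$\mathbb E_{\xi\sim\mathcal D_i}\|\nabla F_i(\mathbf x;\xi)-\nabla f_i(\mathbf x)\|^2\le\sigma^2,\qquad \frac1n\sum_{i=1}^n\|\nabla f_i(\mathbf x)-\nabla f(\mathbf x)\|^2\le\zeta^2 .$$ Let $$D_1=\frac{2}{(1-(q+p\rho)^{1/2})^2},\qquad D_2=\frac{2}{1-(q+p\rho^2)},\qquad \gamma=\frac{1}{2\sqrt{3D_1}\,L+\frac{\sigma}{\sqrt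 n}\sqrt T}$$ with $T\ge 1$. Then $\gamma>0$, $1-3D_1L^2\gamma^2>0$, every $\mathbb E\|\nabla f(\overline X_t)\|^2$ is finite, and $$\frac1T\sum_{t=1}^T\mathbb E\|\nabla f(\overline X_t)\|^2\le\frac{6\sigma(f(\overline X_0)-f^*)+3L\sigma}{2\sqrt{nT}}+\frac{6\sqrt3\,\sqrt{D_1}\,L(f(\overline X_0)-f^*)+2L^2D_1n}{T}+\frac{3L^2D_1n\zeta^2}{\sigma^2T}+\frac{2L^2D_2\|X_0-\overline X_0\mathbf 1_n^{\top}\|_F^2}{nT}.$$ -/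

import Mathlib

open MeasureTheory ProbabilityTheory
open scoped Matrix

namespace SAPS

noncomputable section

/-- The `i`-th column of the matrix `X` of all models: the model of worker `i`. -/
def column {N n : ℕ} (X : Matrix (Fin N) (Fin n) ℝ) (i : Fin n) : EuclideanSpace ℝ (Fin N) :=
  WithLp.toLp 2 fun j => X j i

/-- The average model `X 1 / n`. -/
def average {N n : ℕ} (X : Matrix (Fin N) (Fin n) ℝ) : EuclideanSpace ℝ (Fin N) :=
  (1 / (n : ℝ)) • ∑ i, column X i

/-- The squared Frobenius norm of `X - (X 1 / n) 1ᵀ`. -/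
def consensusErrorSq {N n : ℕ} (X : Matrix (Fin N) (Fin n) ℝ) : ℝ :=
  ∑ j, ∑ i, (X j i - average X j) ^ 2

/-- The local objective of worker `i`: the expectation of `F i x ξ` for `ξ` with law `D i`. -/
def localObjective {N n : ℕ} {Ξ : Fin n → Type*} [∀ i, MeasurableSpace (Ξ i)]
    (D : ∀ i, Measure (Ξ i)) (F : ∀ i, EuclideanSpace ℝ (Fin N) → Ξ i → ℝ)
    (i : Fin n) (x : EuclideanSpace ℝ (Fin N)) : ℝ :=
  ∫ z, F i x z ∂(D i)

/-- The global objective: the average of the local objectives. -/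
def objective {N n : ℕ} {Ξ : Fin n → Type*} [∀ i, MeasurableSpace (Ξ i)]
    (D : ∀ i, Measure (Ξ i)) (F : ∀ i, EuclideanSpace ℝ (Fin N) → Ξ i → ℝ)
    (x : EuclideanSpace ℝ (Fin N)) : ℝ :=
  (1 / (n : ℝ)) * ∑ i, localObjective D F i x

/-- The gradient, with respect to the model, of the loss of worker `i` on the sample `z`. -/
def lossGradient {N n : ℕ} {Ξ : Fin n → Type*}
    (F : ∀ i, EuclideanSpace ℝ (Fin N) → Ξ i → ℝ) (i : Fin n)
    (x : EuclideanSpace ℝ (Fin N)) (z : Ξ i) : EuclideanSpace ℝ (Fin N) :=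
  gradient (fun y => F i y z) x

/-- The stochastic gradient matrix: column `i` is the loss gradient of worker `i` at its own model
and its own sample. -/
def gradientMatrix {N n : ℕ} {Ξ : Fin n → Type*}
    (F : ∀ i, EuclideanSpace ℝ (Fin N) → Ξ i → ℝ) (X : Matrix (Fin N) (Fin n) ℝ)
    (z : ∀ i, Ξ i) : Matrix (Fin N) (Fin n) ℝ :=
  Matrix.of fun j i => lossGradient F i (column X i) (z i) j

/-- The mask matrix, all of whose columns are the same 0/1 mask vector. -/
def maskMatrix {N : ℕ} (n : ℕ) (m : Fin N → Bool) : Matrix (Fin N) (Fin n) ℝ :=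
  Matrix.of fun j _ => if m j then 1 else 0

/-- One iteration: the masked coordinates are mixed by the gossip matrix `W`, the others are kept,
and every worker makes a stochastic gradient step with step size `γ`. -/
def step {N n : ℕ} {Ξ : Fin n → Type*}
    (F : ∀ i, EuclideanSpace ℝ (Fin N) → Ξ i → ℝ) (γ : ℝ)
    (X : Matrix (Fin N) (Fin n) ℝ) (m : Fin N → Bool) (W : Matrix (Fin n) (Fin n) ℝ)
    (z : ∀ i, Ξ i) : Matrix (Fin N) (Fin n) ℝ :=
  X ⊙ maskMatrix n (fun j => !(m j)) + (X ⊙ maskMatrix n m) * W - γ • gradientMatrix F X z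

/-- The SAPS-PSGD iterates with constant step size `γ`, started at `X₀`. -/
def iterates {N n : ℕ} {Ω : Type*} {Ξ : Fin n → Type*}
    (F : ∀ i, EuclideanSpace ℝ (Fin N) → Ξ i → ℝ) (γ : ℝ) (X₀ : Matrix (Fin N) (Fin n) ℝ)
    (W : ℕ → Ω → Matrix (Fin n) (Fin n) ℝ) (m : ℕ → Fin N → Ω → Bool)
    (ξ : ℕ → ∀ i, Ω → Ξ i) : ℕ → Ω → Matrix (Fin N) (Fin n) ℝ
  | 0, _ => X₀
  | t + 1, ω =>
      step F γ (iterates F γ X₀ W m ξ t ω) (fun j => m t j ω) (W t ω) (fun i => ξ t i ω)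

/-- Labels of the elementary random inputs: the gossip matrix of iteration `t`, the mask bit of
coordinate `j` at iteration `t`, and the sample drawn by worker `i` at iteration `t`. -/
inductive Source (N n : ℕ) : Type
  | gossip (t : ℕ) : Source N n
  | mask (t : ℕ) (j : Fin N) : Source N n
  | sample (t : ℕ) (i : Fin n) : Source N n

/-- Matrices carry the product sigma-algebra. -/
instance matrixMeasurableSpace {k l : Type*} : MeasurableSpace (Matrix k l ℝ) :=
  MeasurableSpace.pi

/-- The sigma-algebra generated by each elementary random input. -/
@[reducible]
def sourceAlgebra {N n : ℕ} {Ω : Type*} {Ξ : Fin n → Type*} [∀ i, MeasurableSpace (Ξ i)]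
    (W : ℕ → Ω → Matrix (Fin n) (Fin n) ℝ) (m : ℕ → Fin N → Ω → Bool)
    (ξ : ℕ → ∀ i, Ω → Ξ i) : Source N n → MeasurableSpace Ω
  | .gossip t => MeasurableSpace.comap (W t) inferInstance
  | .mask t j => MeasurableSpace.comap (m t j) inferInstance
  | .sample t i => MeasurableSpace.comap (ξ t i) inferInstance

/-- The expectation (entry by entry) of `W Wᵀ`. Models are the columns of `X` and gossip acts by
`X ↦ X W`, so this is the matrix of the quadratic form `v ↦ E ‖v W‖²` on row vectors; for symmetric
`W` it is also the expectation of `Wᵀ W`. -/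
def gossipSecondMoment {n : ℕ} {Ω : Type*} [MeasurableSpace Ω] (P : Measure Ω)
    (W : Ω → Matrix (Fin n) (Fin n) ℝ) : Matrix (Fin n) (Fin n) ℝ :=
  Matrix.of fun k l => ∫ ω, (W ω * (W ω)ᵀ) k l ∂P

theorem gossipSecondMoment_isHermitian {n : ℕ} {Ω : Type*} [MeasurableSpace Ω] (P : Measure Ω)
    (W : Ω → Matrix (Fin n) (Fin n) ℝ) : (gossipSecondMoment P W).IsHermitian := by
  ext k l
  simp only [Matrix.conjTranspose_apply, gossipSecondMoment, Matrix.of_apply, star_trivial]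
  congr 1
  ext ω
  simp only [Matrix.mul_apply, Matrix.transpose_apply]
  exact Finset.sum_congr rfl fun i _ => mul_comm _ _

theorem gossipSecondMoment_eq_of_symm {n : ℕ} {Ω : Type*} [MeasurableSpace Ω] (P : Measure Ω)
    (W : Ω → Matrix (Fin n) (Fin n) ℝ) (hW : ∀ᵐ ω ∂P, (W ω).IsSymm) :
    gossipSecondMoment P W = Matrix.of fun k l => ∫ ω, ((W ω)ᵀ * W ω) k l ∂P := by
  ext k l
  refine integral_congr_ae ?_
  filter_upwards [hW] with ω h
  rw [h.eq]

/-- The second largest eigenvalue, with multiplicity, of a symmetric matrix of size at least two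
(`eigenvalues₀` lists the eigenvalues in decreasing order). -/
def secondLargestEigenvalue {n : ℕ} (hn : 2 ≤ n) {A : Matrix (Fin n) (Fin n) ℝ}
    (hA : A.IsHermitian) : ℝ :=
  hA.eigenvalues₀ ⟨1, by rw [Fintype.card_fin]; omega⟩

end

end SAPS

/-! The proof couples a descent estimate for the averaged model with a contraction estimate for the
distance to consensus.

Doubly stochastic gossip, masked or not, leaves the average unchanged, so the averaged model
performs a noisy gradient step along the mean of the local gradients. Smoothness turns this into
`Assumptions.descent`: each step gains `γ / 2 * ‖∇f‖ ^ 2` in expectation, up to a multiple of the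
consensus error (the local gradients are taken at the wrong points) and a noise term. The noise term
carries `σ ^ 2 / n`, because the noises of different workers are orthogonal in `L²`.

For the consensus error, each coordinate is treated separately. A row of deviations from the mean is
orthogonal to the constant vector, hence is contracted in mean square by `ρ` when it is mixed, and
is kept otherwise; independence gives the factor `q + p * ρ = s ^ 2` (`integral_masked_gossip_le`,
resting on `dotProduct_mulVec_le_secondLargestEigenvalue`). The gradient step adds drift from model
disagreement, drift from data heterogeneity, and noise. A weighted Cauchy–Schwarz inequality
separates the drifts, and the noise is uncorrelated with everything else. The step size is small
enough that half of the gap `1 - s ^ 2` survives (`Assumptions.consensus_step`,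
`contraction_factor_le`), so the affine recursion can be summed (`sum_consensus_le`).

Telescoping the descent estimate controls the gradients at times `0, ..., T - 1`. The remaining time
`T` is paid for by `‖∇f‖ ^ 2 ≤ 2 / γ * (f - f*)`, which exactly replaces the final objective value
by the infimum (`sum_gradient_le`). The choice of `γ` then gives the rate. -/

namespace SAPS

/-! ### Smooth functions -/

section Smooth

variable {E : Type*} [NormedAddCommGroup E] [InnerProductSpace ℝ E] [CompleteSpace E]

/-- The restriction to the segment from `x` to `x + d`, minus the claimed quadratic bound along it,
has nonpositive derivative on `[0, 1]` by Cauchy–Schwarz and the Lipschitz condition. -/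
theorem le_quadratic_of_gradient_lipschitz {f : E → ℝ} {L : ℝ} (hf : Differentiable ℝ f)
    (hlip : ∀ x y, ‖gradient f x - gradient f y‖ ≤ L * ‖x - y‖) (x d : E) :
    f (x + d) ≤ f x + inner ℝ (gradient f x) d + L / 2 * ‖d‖ ^ 2 := by
  have hline : ∀ s : ℝ, HasDerivAt (fun s : ℝ => f (x + s • d))
      (inner ℝ (gradient f (x + s • d)) d) s := by
    intro s
    have h1 := (hf (x + s • d)).hasGradientAt.hasFDerivAt
    have h2 : HasDerivAt (fun s : ℝ => x + s • d) d s := by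
      simpa using ((hasDerivAt_id s).smul_const d).const_add x
    simpa [Function.comp_def] using h1.comp_hasDerivAt s h2
  have hder : ∀ s : ℝ, HasDerivAt
      (fun s : ℝ => f (x + s • d) - s * inner ℝ (gradient f x) d - L / 2 * ‖d‖ ^ 2 * s ^ 2)
      (inner ℝ (gradient f (x + s • d)) d - inner ℝ (gradient f x) d - L * ‖d‖ ^ 2 * s) s := by
    intro s
    have h2 : HasDerivAt (fun s : ℝ => s * inner ℝ (gradient f x) d)
        (inner ℝ (gradient f x) d) s := by
      simpa using (hasDerivAt_id s).mul_const (inner ℝ (gradient f x) d)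
    have h3 : HasDerivAt (fun s : ℝ => L / 2 * ‖d‖ ^ 2 * s ^ 2) (L * ‖d‖ ^ 2 * s) s := by
      refine ((hasDerivAt_pow 2 s).const_mul (L / 2 * ‖d‖ ^ 2)).congr_deriv ?_
      norm_num
      ring
    exact ((hline s).sub h2).sub h3
  have hanti := antitoneOn_of_deriv_nonpos (convex_Icc (0 : ℝ) 1)
    (fun s _ => (hder s).continuousAt.continuousWithinAt)
    (fun s _ => (hder s).differentiableAt.differentiableWithinAt) (by
      intro s hs
      rw [interior_Icc] at hs
      rw [(hder s).deriv, ← inner_sub_left]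
      have h1 := (real_inner_le_norm (gradient f (x + s • d) - gradient f x) d)
      have h2 := hlip (x + s • d) x
      rw [add_sub_cancel_left, norm_smul, Real.norm_of_nonneg hs.1.le] at h2
      nlinarith [mul_le_mul_of_nonneg_right h2 (norm_nonneg d)])
  have h := hanti (Set.left_mem_Icc.2 zero_le_one) (Set.right_mem_Icc.2 zero_le_one) zero_le_one
  simp only [one_smul, zero_smul, add_zero] at h
  linarith

/-- A gradient step of size `γ` lowers `f` by at least `γ / 2 * ‖∇f‖ ^ 2`, and cannot go below `c`.
-/
theorem sq_norm_gradient_le {f : E → ℝ} {L γ c : ℝ} (hf : Differentiable ℝ f)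
    (hlip : ∀ x y, ‖gradient f x - gradient f y‖ ≤ L * ‖x - y‖) (hγ : 0 < γ) (hLγ : L * γ ≤ 1)
    (hc : ∀ x, c ≤ f x) (x : E) :
    ‖gradient f x‖ ^ 2 ≤ 2 / γ * (f x - c) := by
  have h := le_quadratic_of_gradient_lipschitz hf hlip x (-(γ • gradient f x))
  rw [inner_neg_right, real_inner_smul_right, real_inner_self_eq_norm_sq, norm_neg, norm_smul,
    Real.norm_of_nonneg hγ.le] at h
  have h1 := hc (x + -(γ • gradient f x))
  rw [div_mul_eq_mul_div, le_div_iff₀ hγ]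
  nlinarith [mul_le_mul_of_nonneg_right hLγ (mul_nonneg hγ.le (sq_nonneg ‖gradient f x‖))]

end Smooth

/-! ### Norm inequalities -/

/-- Cauchy–Schwarz in the form of Sedrakyan's inequality. The weights stay free so that the mixed
models can later receive a weight close to `1` when the spectral gap is small. -/
theorem sq_norm_add_add_le {E : Type*} [SeminormedAddCommGroup E] (u v w : E)
    {α β κ : ℝ} (hα : 0 < α) (hβ : 0 < β) (hκ : 0 < κ) (h : α + β + κ = 1) :
    ‖u + v + w‖ ^ 2 ≤ ‖u‖ ^ 2 / α + ‖v‖ ^ 2 / β + ‖w‖ ^ 2 / κ := by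
  have h1 : ‖u + v + w‖ ≤ ‖u‖ + ‖v‖ + ‖w‖ := norm_add₃_le
  have h2 : (‖u‖ + ‖v‖ + ‖w‖) ^ 2 ≤ ‖u‖ ^ 2 / α + ‖v‖ ^ 2 / β + ‖w‖ ^ 2 / κ := by
    have h3 := Finset.sum_sq_le_sum_mul_sum_of_sq_le_mul (Finset.univ : Finset (Fin 3))
      (r := ![‖u‖, ‖v‖, ‖w‖]) (f := ![α, β, κ])
      (g := ![‖u‖ ^ 2 / α, ‖v‖ ^ 2 / β, ‖w‖ ^ 2 / κ])
      (by intro i _; fin_cases i <;> simp [hα.le, hβ.le, hκ.le])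
      (by intro i _; fin_cases i <;> simp <;> positivity)
      (by intro i _; fin_cases i <;> simp <;> field_simp <;> rfl)
    simpa [Fin.sum_univ_three, h] using h3
  exact (pow_le_pow_left₀ (norm_nonneg _) h1 2).trans h2

section Norm

variable {E : Type*} [NormedAddCommGroup E] [InnerProductSpace ℝ E]

theorem sum_sq_norm_sub_mean_le {n : ℕ} (v : Fin n → E) :
    ∑ i, ‖v i - (1 / (n : ℝ)) • ∑ k, v k‖ ^ 2 ≤ ∑ i, ‖v i‖ ^ 2 := by
  rcases Nat.eq_zero_or_pos n with rfl | hn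
  · simp
  have hn' : (n : ℝ) ≠ 0 := by positivity
  set a := (1 / (n : ℝ)) • ∑ k, v k with ha
  have hsum : ∑ k, v k = (n : ℝ) • a := by rw [ha, smul_smul, mul_one_div_cancel hn', one_smul]
  have h : ∑ i, ‖v i - a‖ ^ 2 = ∑ i, ‖v i‖ ^ 2 - n * ‖a‖ ^ 2 := by
    simp only [norm_sub_sq_real, Finset.sum_add_distrib, Finset.sum_sub_distrib, ← Finset.mul_sum,
      ← sum_inner, hsum, real_inner_smul_left, real_inner_self_eq_norm_sq, Finset.sum_const,
      Finset.card_univ, Fintype.card_fin, nsmul_eq_mul]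
    ring
  rw [h]
  have : (0 : ℝ) ≤ n * ‖a‖ ^ 2 := by positivity
  linarith

theorem sq_norm_mean_le {n : ℕ} (v : Fin n → E) :
    ‖(1 / (n : ℝ)) • ∑ k, v k‖ ^ 2 ≤ 1 / (n : ℝ) * ∑ i, ‖v i‖ ^ 2 := by
  rcases Nat.eq_zero_or_pos n with rfl | hn
  · simp
  have hn' : (0 : ℝ) < n := by positivity
  have h1 : ‖∑ k, v k‖ ^ 2 ≤ n * ∑ i, ‖v i‖ ^ 2 := by
    refine (pow_le_pow_left₀ (norm_nonneg _) (norm_sum_le _ _) 2).trans ?_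
    simpa using sq_sum_le_card_mul_sum_sq (s := Finset.univ) (f := fun i => ‖v i‖)
  rw [norm_smul, mul_pow, Real.norm_of_nonneg (by positivity)]
  calc (1 / (n : ℝ)) ^ 2 * ‖∑ k, v k‖ ^ 2
      ≤ (1 / (n : ℝ)) ^ 2 * (n * ∑ i, ‖v i‖ ^ 2) := by gcongr
    _ = _ := by field_simp

end Norm

/-! ### The spectral gap -/

/-- An eigenvector `b i` other than the first has eigenvalue at most `ρ < 1`, while `A 1 = 1` forces
`(1 - lam i) * ⟨b i, 1⟩ = 0`; so it is orthogonal to `1`. Hence `1` spans the line of the first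
eigenvector, and `v` has no component there. The top eigenvalue itself never has to be identified.
-/
theorem dotProduct_mulVec_le_secondLargestEigenvalue {n : ℕ} (hn : 2 ≤ n)
    {A : Matrix (Fin n) (Fin n) ℝ} (hA : A.IsHermitian) (hA1 : A *ᵥ 1 = 1)
    (hlt : secondLargestEigenvalue hn hA < 1) {v : Fin n → ℝ} (hv : ∑ i, v i = 0) :
    v ⬝ᵥ A *ᵥ v ≤ secondLargestEigenvalue hn hA * ∑ i, v i ^ 2 := by
  set ρ := secondLargestEigenvalue hn hA with hρ
  set b := hA.eigenvectorBasis
  set lam := hA.eigenvalues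
  have hsymm : ∀ x y : Fin n → ℝ, x ⬝ᵥ A *ᵥ y = (A *ᵥ x) ⬝ᵥ y := by
    intro x y
    rw [Matrix.dotProduct_mulVec, ← Matrix.mulVec_transpose]
    exact congrArg (fun B => (B *ᵥ x) ⬝ᵥ y) (by simpa [Matrix.IsSymm] using hA)
  have heig : ∀ i (y : Fin n → ℝ), ⇑(b i) ⬝ᵥ A *ᵥ y = lam i * (⇑(b i) ⬝ᵥ y) := by
    intro i y
    rw [hsymm, hA.mulVec_eigenvectorBasis, smul_dotProduct, smul_eq_mul]
  have hinner : ∀ i (y : Fin n → ℝ), inner ℝ (b i) (WithLp.toLp 2 y) = ⇑(b i) ⬝ᵥ y := by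
    intro i y
    simp [EuclideanSpace.inner_eq_star_dotProduct, dotProduct_comm]
  -- all eigenvalues but the first are at most `ρ`
  let e : Fin n ≃ Fin (Fintype.card (Fin n)) := (Fintype.equivOfCardEq (Fintype.card_fin _)).symm
  have hlam : ∀ i, lam i = hA.eigenvalues₀ (e i) := fun i => rfl
  have hle : ∀ i, (e i : ℕ) ≠ 0 → lam i ≤ ρ := by
    intro i hi
    rw [hlam]
    exact hA.eigenvalues₀_antitone (Fin.mk_le_of_le_val (Nat.one_le_iff_ne_zero.2 hi))
  have horth : ∀ i, (e i : ℕ) ≠ 0 → ⇑(b i) ⬝ᵥ (1 : Fin n → ℝ) = 0 := by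
    intro i hi
    have h := heig i 1
    rw [hA1] at h
    have h1 := hle i hi
    have h2 : (1 - lam i) * (⇑(b i) ⬝ᵥ (1 : Fin n → ℝ)) = 0 := by linarith
    rcases mul_eq_zero.1 h2 with h3 | h3
    · linarith
    · exact h3
  let i₀ : Fin n := e.symm ⟨0, by rw [Fintype.card_fin]; omega⟩
  have hi₀ : ∀ i, i ≠ i₀ → (e i : ℕ) ≠ 0 := by
    intro i hi h
    exact hi (by simp [i₀, Equiv.eq_symm_apply, Fin.ext_iff, h])
  have hone : WithLp.toLp 2 (1 : Fin n → ℝ) = (⇑(b i₀) ⬝ᵥ (1 : Fin n → ℝ)) • b i₀ := by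
    rw [← b.sum_repr' (WithLp.toLp 2 (1 : Fin n → ℝ)), Finset.sum_eq_single i₀]
    · rw [hinner]
    · intro i _ hi
      rw [hinner, horth i (hi₀ i hi), zero_smul]
    · simp
  -- Otherwise the constant vector `1` would vanish.
  have hc : ⇑(b i₀) ⬝ᵥ (1 : Fin n → ℝ) ≠ 0 := by
    intro h
    rw [h, zero_smul] at hone
    have := congrArg (fun z : EuclideanSpace ℝ (Fin n) => z ⟨0, by omega⟩) hone
    simp at this
  have hv₀ : ⇑(b i₀) ⬝ᵥ v = 0 := by
    have h : inner ℝ (WithLp.toLp 2 (1 : Fin n → ℝ)) (WithLp.toLp 2 v) = 0 := by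
      simp [EuclideanSpace.inner_eq_star_dotProduct, dotProduct, hv]
    rw [hone, real_inner_smul_left, hinner] at h
    exact (mul_eq_zero.1 h).resolve_left hc
  have hquad : v ⬝ᵥ A *ᵥ v = ∑ i, lam i * (⇑(b i) ⬝ᵥ v) ^ 2 := by
    have h : inner ℝ (WithLp.toLp 2 v) (WithLp.toLp 2 (A *ᵥ v)) = v ⬝ᵥ A *ᵥ v := by
      simp [EuclideanSpace.inner_eq_star_dotProduct, dotProduct_comm]
    rw [← h, ← b.sum_inner_mul_inner]
    refine Finset.sum_congr rfl fun i _ => ?_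
    rw [hinner, heig, real_inner_comm, hinner]
    ring
  have hnorm : ∑ i, v i ^ 2 = ∑ i, (⇑(b i) ⬝ᵥ v) ^ 2 := by
    have h : inner ℝ (WithLp.toLp 2 v) (WithLp.toLp 2 v) = ∑ i, v i ^ 2 := by
      simp [EuclideanSpace.real_norm_sq_eq]
    rw [← h, ← b.sum_inner_mul_inner]
    refine Finset.sum_congr rfl fun i _ => ?_
    rw [hinner, real_inner_comm, hinner]
    ring
  rw [hquad, hnorm, Finset.mul_sum]
  refine Finset.sum_le_sum fun i _ => ?_
  by_cases hi : i = i₀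
  · rw [hi, hv₀]; simp
  · exact mul_le_mul_of_nonneg_right (hle i (hi₀ i hi)) (sq_nonneg _)

/-- Gives `ρ ≥ 0`, so that the radicand `q + p * ρ` is nonnegative and its root squares back to it.
-/
theorem secondLargestEigenvalue_nonneg {n : ℕ} (hn : 2 ≤ n) {A : Matrix (Fin n) (Fin n) ℝ}
    (hA : A.IsHermitian) (hpos : ∀ v : Fin n → ℝ, 0 ≤ v ⬝ᵥ A *ᵥ v) :
    0 ≤ secondLargestEigenvalue hn hA := by
  have hps : A.PosSemidef := Matrix.PosSemidef.of_dotProduct_mulVec_nonneg hA (by simpa using hpos)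
  let e : Fin n ≃ Fin (Fintype.card (Fin n)) := (Fintype.equivOfCardEq (Fintype.card_fin _)).symm
  have h := hps.eigenvalues_nonneg (e.symm ⟨1, by rw [Fintype.card_fin]; omega⟩)
  have h2 : hA.eigenvalues (e.symm ⟨1, by rw [Fintype.card_fin]; omega⟩)
      = secondLargestEigenvalue hn hA := by
    change hA.eigenvalues₀ (e (e.symm _)) = _
    rw [e.apply_symm_apply]
    rfl
  exact h2 ▸ h

/-! ### Square-integrable random vectors -/

section Probability

variable {Ω : Type*} [MeasurableSpace Ω] {P : Measure Ω}

theorem memLp_integrable_inner {E : Type*} [NormedAddCommGroup E] [InnerProductSpace ℝ E]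
    {f g : Ω → E} (hf : MemLp f 2 P) (hg : MemLp g 2 P) :
    Integrable (fun ω => inner ℝ (f ω) (g ω)) P :=
  (hf.norm.integrable_mul hg.norm).mono (hf.1.inner hg.1) (by
    filter_upwards with ω
    simpa using norm_inner_le_norm (𝕜 := ℝ) (f ω) (g ω))

theorem memLp_integrable_sq_norm {E : Type*} [NormedAddCommGroup E] {f : Ω → E}
    (hf : MemLp f 2 P) : Integrable (fun ω => ‖f ω‖ ^ 2) P :=
  (memLp_two_iff_integrable_sq_norm hf.1).1 hf

theorem Indep.indepFun_of_measurable {α β : Type*} [MeasurableSpace α] [MeasurableSpace β]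
    {m₁ m₂ : MeasurableSpace Ω} (h : Indep m₁ m₂ P) {f : Ω → α} {g : Ω → β}
    (hf : Measurable[m₁] f) (hg : Measurable[m₂] g) : IndepFun f g P :=
  (IndepFun_iff_Indep f g P).2
    (indep_of_indep_of_le_left (indep_of_indep_of_le_right h hg.comap_le) hf.comap_le)

/-! ### Stochastic gradients evaluated at an independent point -/

variable [IsProbabilityMeasure P] {Ξ : Type*} [MeasurableSpace Ξ] {D : Measure Ξ}
  [IsProbabilityMeasure D] {N : ℕ}
  {g : EuclideanSpace ℝ (Fin N) → Ξ → EuclideanSpace ℝ (Fin N)}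
  {G : EuclideanSpace ℝ (Fin N) → EuclideanSpace ℝ (Fin N)}
  {z : Ω → Ξ} {x φ : Ω → EuclideanSpace ℝ (Fin N)}

/-- By independence the joint law of `(φ, x)` and `z` is a product; integrating over the sample
first, with `φ` and `x` frozen, gives zero by unbiasedness. -/
theorem integral_inner_noise_eq_zero (hz : Measurable z) (hx : Measurable x) (hφ : Measurable φ)
    (hg : Measurable (fun a : EuclideanSpace ℝ (Fin N) × Ξ => g a.1 a.2)) (hG : Measurable G)
    (hlaw : P.map z = D) (hindep : IndepFun (fun ω => (φ ω, x ω)) z P)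
    (hunb : ∀ y, Integrable (g y) D ∧ ∫ w, g y w ∂D = G y) :
    ∫ ω, inner ℝ (φ ω) (g (x ω) (z ω) - G (x ω)) ∂P = 0 := by
  set H : (EuclideanSpace ℝ (Fin N) × EuclideanSpace ℝ (Fin N)) × Ξ → ℝ :=
    fun a => inner ℝ a.1.1 (g a.1.2 a.2 - G a.1.2) with hH
  have hHm : Measurable H := by
    have h1 : Measurable fun a : (EuclideanSpace ℝ (Fin N) × EuclideanSpace ℝ (Fin N)) × Ξ =>
        g a.1.2 a.2 := hg.comp (by fun_prop : Measurable fun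
          a : (EuclideanSpace ℝ (Fin N) × EuclideanSpace ℝ (Fin N)) × Ξ => (a.1.2, a.2))
    exact (measurable_fst.comp measurable_fst).inner (h1.sub (by fun_prop))
  have hφx : Measurable (fun ω => (φ ω, x ω)) := hφ.prodMk hx
  have hmap := (indepFun_iff_map_prod_eq_prod_map_map hφx.aemeasurable hz.aemeasurable).1 hindep
  rw [hlaw] at hmap
  have hP : ∫ ω, inner ℝ (φ ω) (g (x ω) (z ω) - G (x ω)) ∂P
      = ∫ a, H a ∂((P.map fun ω => (φ ω, x ω)).prod D) := by
    rw [← hmap, integral_map (hφx.prodMk hz).aemeasurable hHm.aestronglyMeasurable]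
  have : IsProbabilityMeasure (P.map fun ω => (φ ω, x ω)) :=
    Measure.isProbabilityMeasure_map hφx.aemeasurable
  rw [hP]
  by_cases hint : Integrable H ((P.map fun ω => (φ ω, x ω)).prod D)
  · rw [integral_prod _ hint]
    refine integral_eq_zero_of_ae (Filter.Eventually.of_forall fun a => ?_)
    simp only [hH, Pi.zero_apply]
    have hi : Integrable (fun w => g a.2 w - G a.2) D := (hunb a.2).1.sub (integrable_const _)
    rw [integral_inner hi,
      integral_sub (hunb a.2).1 (integrable_const _), (hunb a.2).2]
    simp
  -- The Bochner integral of a non-integrable function is `0`, so no moment condition on `φ` is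
  -- required.
  · exact integral_undef hint

/-- Tonelli over the product law: the variance bound holds on every fibre, uniformly in the frozen
point, so no moments of `x` enter. -/
theorem memLp_noise (hz : Measurable z) (hx : Measurable x)
    (hg : Measurable (fun a : EuclideanSpace ℝ (Fin N) × Ξ => g a.1 a.2)) (hG : Measurable G)
    (hlaw : P.map z = D) (hindep : IndepFun x z P) {v : ℝ}
    (hvar : ∀ y, Integrable (fun w => ‖g y w - G y‖ ^ 2) D ∧ ∫ w, ‖g y w - G y‖ ^ 2 ∂D ≤ v) :
    MemLp (fun ω => g (x ω) (z ω) - G (x ω)) 2 P ∧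
      ∫ ω, ‖g (x ω) (z ω) - G (x ω)‖ ^ 2 ∂P ≤ v := by
  set H : EuclideanSpace ℝ (Fin N) × Ξ → ℝ := fun a => ‖g a.1 a.2 - G a.1‖ ^ 2 with hH
  have hHm : Measurable H := by
    exact (hg.sub (by fun_prop)).norm.pow_const 2
  have hmap := (indepFun_iff_map_prod_eq_prod_map_map hx.aemeasurable hz.aemeasurable).1 hindep
  rw [hlaw] at hmap
  have : IsProbabilityMeasure (P.map x) := Measure.isProbabilityMeasure_map hx.aemeasurable
  have hv : Integrable (fun y => ∫ w, H (y, w) ∂D) (P.map x) := by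
    refine (integrable_const v).mono' hHm.stronglyMeasurable.integral_prod_right'.aestronglyMeasurable
      (Filter.Eventually.of_forall fun y => ?_)
    rw [Real.norm_of_nonneg (integral_nonneg fun w => sq_nonneg _)]
    exact (hvar y).2
  have hint : Integrable H ((P.map x).prod D) := by
    refine (integrable_prod_iff hHm.aestronglyMeasurable).2
      ⟨Filter.Eventually.of_forall fun y => (hvar y).1, hv.congr ?_⟩
    refine Filter.Eventually.of_forall fun y => integral_congr_ae ?_
    exact Filter.Eventually.of_forall fun w => (Real.norm_of_nonneg (sq_nonneg _)).symm
  have hm : AEStronglyMeasurable (fun ω => g (x ω) (z ω) - G (x ω)) P :=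
    ((hg.comp (hx.prodMk hz)).sub (hG.comp hx)).aestronglyMeasurable
  refine ⟨(memLp_two_iff_integrable_sq_norm hm).2 ?_, ?_⟩
  · rw [← hmap] at hint
    exact hint.comp_measurable (hx.prodMk hz)
  · calc ∫ ω, ‖g (x ω) (z ω) - G (x ω)‖ ^ 2 ∂P = ∫ a, H a ∂((P.map x).prod D) := by
          rw [← hmap, integral_map (hx.prodMk hz).aemeasurable hHm.aestronglyMeasurable]
      _ = ∫ y, ∫ w, H (y, w) ∂D ∂(P.map x) := integral_prod _ hint
      _ ≤ ∫ _, v ∂(P.map x) := integral_mono hv (integrable_const v) fun y => (hvar y).2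
      _ = v := by simp

end Probability

/-! ### Randomly masked gossip -/

section Gossip

variable {Ω : Type*} [MeasurableSpace Ω] {P : Measure Ω} [IsProbabilityMeasure P] {n : ℕ}

theorem dotProduct_mul_transpose (W : Matrix (Fin n) (Fin n) ℝ) (v : Fin n → ℝ) :
    ∑ i, (∑ k, v k * W k i) ^ 2 = ∑ k, ∑ l, v k * v l * (W * Wᵀ) k l := by
  simp only [sq, Finset.sum_mul_sum]
  simp only [Matrix.mul_apply, Matrix.transpose_apply, Finset.mul_sum]
  rw [Finset.sum_comm]
  refine Finset.sum_congr rfl fun k _ => ?_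
  rw [Finset.sum_comm]
  exact Finset.sum_congr rfl fun l _ => Finset.sum_congr rfl fun i _ => by ring

theorem mul_transpose_mem_doublyStochastic {W : Matrix (Fin n) (Fin n) ℝ}
    (hW : W ∈ doublyStochastic ℝ (Fin n)) : W * Wᵀ ∈ doublyStochastic ℝ (Fin n) :=
  mul_mem hW (transpose_mem_doublyStochastic_iff.2 hW)

theorem measurable_mul_transpose_apply {W : Ω → Matrix (Fin n) (Fin n) ℝ} (hW : Measurable W)
    (k l : Fin n) : Measurable fun ω => (W ω * (W ω)ᵀ) k l := by
  have h : ∀ a b, Measurable fun ω => W ω a b := fun a b =>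
    (measurable_pi_apply b).comp ((measurable_pi_apply a).comp hW)
  simp only [Matrix.mul_apply, Matrix.transpose_apply]
  exact Finset.measurable_sum _ fun i _ => (h k i).mul (h l i)

theorem integrable_mul_transpose_apply {W : Ω → Matrix (Fin n) (Fin n) ℝ} (hW : Measurable W)
    (hds : ∀ᵐ ω ∂P, W ω ∈ doublyStochastic ℝ (Fin n)) (k l : Fin n) :
    Integrable (fun ω => (W ω * (W ω)ᵀ) k l) P := by
  refine (integrable_const (1 : ℝ)).mono'
    (measurable_mul_transpose_apply hW k l).aestronglyMeasurable ?_
  filter_upwards [hds] with ω h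
  have h2 := mul_transpose_mem_doublyStochastic h
  rw [Real.norm_of_nonneg (nonneg_of_mem_doublyStochastic h2)]
  exact le_one_of_mem_doublyStochastic h2

theorem gossipSecondMoment_mulVec_one {W : Ω → Matrix (Fin n) (Fin n) ℝ} (hW : Measurable W)
    (hds : ∀ᵐ ω ∂P, W ω ∈ doublyStochastic ℝ (Fin n)) : gossipSecondMoment P W *ᵥ 1 = 1 := by
  ext k
  simp only [Matrix.mulVec, dotProduct, gossipSecondMoment, Matrix.of_apply, Pi.one_apply, mul_one]
  rw [← integral_finsetSum _ fun l _ => integrable_mul_transpose_apply hW hds k l]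
  have h : (fun ω => ∑ l, (W ω * (W ω)ᵀ) k l) =ᵐ[P] fun _ => 1 := by
    filter_upwards [hds] with ω h
    exact sum_row_of_mem_doublyStochastic (mul_transpose_mem_doublyStochastic h) k
  rw [integral_congr_ae h]
  simp

theorem dotProduct_gossipSecondMoment_nonneg {W : Ω → Matrix (Fin n) (Fin n) ℝ} (hW : Measurable W)
    (hds : ∀ᵐ ω ∂P, W ω ∈ doublyStochastic ℝ (Fin n)) (v : Fin n → ℝ) :
    0 ≤ v ⬝ᵥ gossipSecondMoment P W *ᵥ v := by
  have h : v ⬝ᵥ gossipSecondMoment P W *ᵥ v = ∫ ω, ∑ i, (∑ k, v k * W ω k i) ^ 2 ∂P := by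
    simp only [dotProduct_mul_transpose]
    rw [integral_finsetSum _ fun k _ => integrable_finsetSum _ fun l _ =>
      (integrable_mul_transpose_apply hW hds k l).const_mul _]
    simp only [dotProduct, Matrix.mulVec, Finset.mul_sum, gossipSecondMoment, Matrix.of_apply]
    refine Finset.sum_congr rfl fun k _ => ?_
    rw [integral_finsetSum _ fun l _ => (integrable_mul_transpose_apply hW hds k l).const_mul _]
    refine Finset.sum_congr rfl fun l _ => ?_
    rw [integral_const_mul]
    ring
  rw [h]
  exact integral_nonneg fun ω => Finset.sum_nonneg fun i _ => sq_nonneg _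

/-- This concerns one coordinate of the models, with mask bit `b` and deviations `Y` from the mean.
Independence replaces `b` by `p` and `W Wᵀ` by its expectation inside the quadratic form; the
spectral bound then applies pointwise, since `Y` sums to zero. -/
theorem integral_masked_gossip_le (hn : 2 ≤ n) {W : Ω → Matrix (Fin n) (Fin n) ℝ} {b : Ω → Bool}
    {Y : Ω → Fin n → ℝ} (hW : Measurable W) (hb : Measurable b)
    (hds : ∀ᵐ ω ∂P, W ω ∈ doublyStochastic ℝ (Fin n))
    (hlt : secondLargestEigenvalue hn (gossipSecondMoment_isHermitian P W) < 1)
    (hbW : IndepFun b W P) (hY : IndepFun Y (fun ω => (b ω, W ω)) P)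
    (hYL : ∀ i, MemLp (fun ω => Y ω i) 2 P) (hYm : Measurable Y) (hY0 : ∀ ω, ∑ i, Y ω i = 0)
    {p : ℝ} (hp0 : 0 ≤ p) (hp : P {ω | b ω = true} = ENNReal.ofReal p) :
    ∫ ω, ∑ i, (if b ω then ∑ k, Y ω k * W ω k i else Y ω i) ^ 2 ∂P
      ≤ (1 - p + p * secondLargestEigenvalue hn (gossipSecondMoment_isHermitian P W))
        * ∫ ω, ∑ i, Y ω i ^ 2 ∂P := by
  set β : Bool → ℝ := fun c => if c then 1 else 0 with hβ
  have hβm : Measurable β := measurable_of_finite β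
  have hβb : Measurable fun ω => β (b ω) := hβm.comp hb
  have hβ_norm : ∀ c, ‖β c‖ ≤ 1 := by intro c; cases c <;> simp [hβ]
  have hβ_int : Integrable (fun ω => β (b ω)) P :=
    (integrable_const (1 : ℝ)).mono' hβb.aestronglyMeasurable
      (Filter.Eventually.of_forall fun ω => hβ_norm _)
  have hEβ : ∫ ω, β (b ω) ∂P = p := by
    have h1 : (fun ω => β (b ω)) = Set.indicator {ω | b ω = true} (fun _ => (1 : ℝ)) := by
      ext ω
      simp [hβ, Set.indicator_apply]
    rw [h1, integral_indicator_const (s := {ω | b ω = true}) _ (hb (measurableSet_singleton true))]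
    simp [Measure.real, hp, hp0]
  have hYmi : ∀ i, Measurable fun ω => Y ω i := fun i => (measurable_pi_apply i).comp hYm
  have hYY : ∀ k l, Integrable (fun ω => Y ω k * Y ω l) P := fun k l =>
    (hYL k).integrable_mul (hYL l)
  -- Since `W Wᵀ` is doubly stochastic, its entries lie in `[0, 1]`; square integrability of `Y`
  -- then suffices for all integrability claims.
  have hWW_norm : ∀ k l, ∀ᵐ ω ∂P, ‖β (b ω) * (W ω * (W ω)ᵀ) k l‖ ≤ 1 := by
    intro k l
    filter_upwards [hds] with ω h
    have h2 := mul_transpose_mem_doublyStochastic h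
    rw [norm_mul, Real.norm_of_nonneg (nonneg_of_mem_doublyStochastic h2)]
    exact mul_le_one₀ (hβ_norm _) (nonneg_of_mem_doublyStochastic h2)
      (le_one_of_mem_doublyStochastic h2)
  have hWWm : ∀ k l, Measurable fun ω => β (b ω) * (W ω * (W ω)ᵀ) k l := fun k l =>
    hβb.mul (measurable_mul_transpose_apply hW k l)
  -- the two parts of the integrand
  have hkeep : ∀ i, Integrable (fun ω => Y ω i ^ 2 * (1 - β (b ω))) P := by
    intro i
    refine (hYL i).integrable_sq.mul_bdd (c := 2) (by fun_prop)
      (Filter.Eventually.of_forall fun ω => ?_)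
    cases b ω <;> simp [hβ]
  have hmix : ∀ k l, Integrable
      (fun ω => Y ω k * Y ω l * (β (b ω) * (W ω * (W ω)ᵀ) k l)) P := by
    intro k l
    exact (hYY k l).mul_bdd (hWWm k l).aestronglyMeasurable (hWW_norm k l)
  have hkeep_int : ∀ i, ∫ ω, Y ω i ^ 2 * (1 - β (b ω)) ∂P = (∫ ω, Y ω i ^ 2 ∂P) * (1 - p) := by
    intro i
    have hind : IndepFun (fun ω => Y ω i ^ 2) (fun ω => 1 - β (b ω)) P :=
      hY.comp ((measurable_pi_apply i).pow_const 2)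
        (measurable_const.sub (hβm.comp measurable_fst))
    rw [hind.integral_fun_mul_eq_mul_integral ((hYmi i).pow_const 2).aestronglyMeasurable
      (measurable_const.sub hβb).aestronglyMeasurable,
      integral_sub (integrable_const _) hβ_int, hEβ]
    simp
  have hmix_int : ∀ k l, ∫ ω, Y ω k * Y ω l * (β (b ω) * (W ω * (W ω)ᵀ) k l) ∂P
      = ∫ ω, p * (Y ω k * Y ω l * gossipSecondMoment P W k l) ∂P := by
    intro k l
    have hind : IndepFun (fun ω => Y ω k * Y ω l)
        (fun ω => β (b ω) * (W ω * (W ω)ᵀ) k l) P :=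
      hY.comp (φ := fun y : Fin n → ℝ => y k * y l)
        (ψ := fun a : Bool × Matrix (Fin n) (Fin n) ℝ => β a.1 * (a.2 * a.2ᵀ) k l)
        (by fun_prop)
        ((hβm.comp measurable_fst).mul (measurable_mul_transpose_apply measurable_snd k l))
    have hind2 : IndepFun (fun ω => β (b ω)) (fun ω => (W ω * (W ω)ᵀ) k l) P :=
      hbW.comp (ψ := fun a : Matrix (Fin n) (Fin n) ℝ => (a * aᵀ) k l) hβm
        (measurable_mul_transpose_apply measurable_id k l)
    rw [hind.integral_fun_mul_eq_mul_integral (hYY k l).1 (hWWm k l).aestronglyMeasurable,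
      hind2.integral_fun_mul_eq_mul_integral hβb.aestronglyMeasurable
        (measurable_mul_transpose_apply hW k l).aestronglyMeasurable, hEβ,
      integral_const_mul, integral_mul_const]
    simp only [gossipSecondMoment, Matrix.of_apply]
    ring
  set ρ := secondLargestEigenvalue hn (gossipSecondMoment_isHermitian P W)
  have hsplit : ∀ ω, ∑ i, (if b ω then ∑ k, Y ω k * W ω k i else Y ω i) ^ 2
      = ∑ i, Y ω i ^ 2 * (1 - β (b ω))
        + ∑ k, ∑ l, Y ω k * Y ω l * (β (b ω) * (W ω * (W ω)ᵀ) k l) := by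
    intro ω
    cases h : b ω
    · simp [hβ]
    · simp [hβ, dotProduct_mul_transpose]
  have hYsq : Integrable (fun ω => ∑ i, Y ω i ^ 2) P :=
    integrable_finsetSum _ fun i _ => (hYL i).integrable_sq
  have hquad : ∫ ω, ∑ k, ∑ l, p * (Y ω k * Y ω l * gossipSecondMoment P W k l) ∂P
      ≤ ∫ ω, p * (ρ * ∑ i, Y ω i ^ 2) ∂P := by
    refine integral_mono (integrable_finsetSum _ fun k _ => integrable_finsetSum _ fun l _ =>
      ((hYY k l).mul_const _).const_mul _) ((hYsq.const_mul _).const_mul _) fun ω => ?_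
    have h := dotProduct_mulVec_le_secondLargestEigenvalue hn
      (gossipSecondMoment_isHermitian P W) (gossipSecondMoment_mulVec_one hW hds) hlt (hY0 ω)
    refine le_trans (le_of_eq ?_) (mul_le_mul_of_nonneg_left h hp0)
    simp only [dotProduct, Matrix.mulVec, Finset.mul_sum]
    exact Finset.sum_congr rfl fun k _ => Finset.sum_congr rfl fun l _ => by ring
  simp only [hsplit]
  rw [integral_add (integrable_finsetSum _ fun i _ => hkeep i)
    (integrable_finsetSum _ fun k _ => integrable_finsetSum _ fun l _ => hmix k l),
    integral_finsetSum _ fun i _ => hkeep i,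
    integral_finsetSum _ fun k _ => integrable_finsetSum _ fun l _ => hmix k l]
  simp only [hkeep_int]
  have h2 : ∑ k, ∫ ω, ∑ l, Y ω k * Y ω l * (β (b ω) * (W ω * (W ω)ᵀ) k l) ∂P
      = ∫ ω, ∑ k, ∑ l, p * (Y ω k * Y ω l * gossipSecondMoment P W k l) ∂P := by
    have hI : ∀ k l, Integrable (fun ω => p * (Y ω k * Y ω l * gossipSecondMoment P W k l)) P :=
      fun k l => ((hYY k l).mul_const _).const_mul _
    rw [integral_finsetSum _ fun k _ => integrable_finsetSum _ fun l _ => hI k l]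
    refine Finset.sum_congr rfl fun k _ => ?_
    rw [integral_finsetSum _ fun l _ => hmix k l,
      integral_finsetSum _ fun l _ => hI k l]
    exact Finset.sum_congr rfl fun l _ => hmix_int k l
  rw [h2, ← Finset.sum_mul, ← integral_finsetSum _ fun i _ => (hYL i).integrable_sq]
  rw [integral_const_mul, integral_const_mul] at hquad
  linarith

end Gossip

/-! ### The mixing step -/

section Mixing

variable {N n : ℕ} {Ξ : Fin n → Type*} {F : ∀ i, EuclideanSpace ℝ (Fin N) → Ξ i → ℝ} {γ : ℝ}

/-- The models after the masked gossip exchange, before the gradient step. -/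
def mixed (X : Matrix (Fin N) (Fin n) ℝ) (m : Fin N → Bool) (W : Matrix (Fin n) (Fin n) ℝ) :
    Matrix (Fin N) (Fin n) ℝ :=
  X ⊙ maskMatrix n (fun j => !(m j)) + (X ⊙ maskMatrix n m) * W

theorem mixed_apply (X : Matrix (Fin N) (Fin n) ℝ) (m : Fin N → Bool)
    (W : Matrix (Fin n) (Fin n) ℝ) (j : Fin N) (i : Fin n) :
    mixed X m W j i = if m j then ∑ k, X j k * W k i else X j i := by
  cases h : m j <;> simp [mixed, maskMatrix, Matrix.mul_apply, h]

@[simp]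
theorem column_apply (X : Matrix (Fin N) (Fin n) ℝ) (i : Fin n) (j : Fin N) :
    column X i j = X j i := rfl

theorem average_apply (X : Matrix (Fin N) (Fin n) ℝ) (j : Fin N) :
    average X j = 1 / (n : ℝ) * ∑ i, X j i := by
  simp [average]

/-- Row sums equal to `1` preserve the average. -/
theorem average_mixed (X : Matrix (Fin N) (Fin n) ℝ) (m : Fin N → Bool)
    {W : Matrix (Fin n) (Fin n) ℝ} (hW : W ∈ doublyStochastic ℝ (Fin n)) :
    average (mixed X m W) = average X := by
  ext j
  simp only [average_apply, mixed_apply]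
  cases m j
  · simp
  · simp only [if_true]
    rw [Finset.sum_comm]
    simp only [← Finset.mul_sum, sum_row_of_mem_doublyStochastic hW, mul_one]

/-- Column sums equal to `1` let the average be subtracted before mixing. -/
theorem mixed_sub_average (X : Matrix (Fin N) (Fin n) ℝ) (m : Fin N → Bool)
    {W : Matrix (Fin n) (Fin n) ℝ} (hW : W ∈ doublyStochastic ℝ (Fin n)) (j : Fin N) (i : Fin n) :
    mixed X m W j i - average X j
      = if m j then ∑ k, (X j k - average X j) * W k i else X j i - average X j := by
  rw [mixed_apply]
  cases m j
  · simp
  · simp [sub_mul, ← Finset.mul_sum, sum_col_of_mem_doublyStochastic hW]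

theorem sum_sub_average (hn : n ≠ 0) (X : Matrix (Fin N) (Fin n) ℝ) (j : Fin N) :
    ∑ i, (X j i - average X j) = 0 := by
  have hn' : (n : ℝ) ≠ 0 := Nat.cast_ne_zero.2 hn
  rw [Finset.sum_sub_distrib, average_apply]
  simp only [Finset.sum_const, Finset.card_univ, Fintype.card_fin, nsmul_eq_mul]
  field_simp
  simp

theorem consensusErrorSq_eq (X : Matrix (Fin N) (Fin n) ℝ) :
    consensusErrorSq X = ∑ i, ‖column X i - average X‖ ^ 2 := by
  simp only [consensusErrorSq, EuclideanSpace.real_norm_sq_eq, PiLp.sub_apply, column_apply]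
  exact Finset.sum_comm

theorem column_step (X : Matrix (Fin N) (Fin n) ℝ) (m : Fin N → Bool)
    (W : Matrix (Fin n) (Fin n) ℝ) (z : ∀ i, Ξ i) (i : Fin n) :
    column (step F γ X m W z) i
      = column (mixed X m W) i - γ • lossGradient F i (column X i) (z i) := rfl

theorem average_step (X : Matrix (Fin N) (Fin n) ℝ) (m : Fin N → Bool)
    {W : Matrix (Fin n) (Fin n) ℝ} (hW : W ∈ doublyStochastic ℝ (Fin n)) (z : ∀ i, Ξ i) :
    average (step F γ X m W z)
      = average X - γ • (1 / (n : ℝ)) • ∑ i, lossGradient F i (column X i) (z i) := by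
  rw [← average_mixed X m hW]
  simp only [average, column_step, Finset.sum_sub_distrib, smul_sub, ← Finset.smul_sum]
  rw [smul_comm]

theorem norm_mixed_apply_le (X : Matrix (Fin N) (Fin n) ℝ) (m : Fin N → Bool)
    {W : Matrix (Fin n) (Fin n) ℝ} (hW : W ∈ doublyStochastic ℝ (Fin n)) (j : Fin N) (i : Fin n) :
    ‖mixed X m W j i‖ ≤ ∑ k, ‖X j k‖ := by
  rw [mixed_apply]
  split_ifs
  · refine (norm_sum_le _ _).trans (Finset.sum_le_sum fun k _ => ?_)
    rw [norm_mul, Real.norm_of_nonneg (nonneg_of_mem_doublyStochastic hW)]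
    exact mul_le_of_le_one_right (norm_nonneg _) (le_one_of_mem_doublyStochastic hW)
  · exact Finset.single_le_sum (f := fun k => ‖X j k‖) (fun k _ => norm_nonneg _)
      (Finset.mem_univ i)

/-! ### Measurability of one iteration -/

theorem measurable_entry (j : Fin N) (i : Fin n) :
    Measurable fun X : Matrix (Fin N) (Fin n) ℝ => X j i :=
  (measurable_pi_apply i).comp (measurable_pi_apply j)

theorem measurable_column (i : Fin n) :
    Measurable fun X : Matrix (Fin N) (Fin n) ℝ => column X i :=
  (WithLp.measurable_toLp 2 _).comp (measurable_pi_iff.2 fun j => measurable_entry j i)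

theorem measurable_average : Measurable fun X : Matrix (Fin N) (Fin n) ℝ => average X :=
  (Finset.measurable_sum _ fun i _ => measurable_column i).const_smul (1 / (n : ℝ))

theorem measurable_mixed :
    Measurable fun a : Matrix (Fin N) (Fin n) ℝ × (Fin N → Bool) × Matrix (Fin n) (Fin n) ℝ =>
      mixed a.1 a.2.1 a.2.2 := by
  refine measurable_pi_iff.2 fun j => measurable_pi_iff.2 fun i => ?_
  have h : ∀ k, Measurable fun a : Matrix (Fin N) (Fin n) ℝ × (Fin N → Bool) ×
      Matrix (Fin n) (Fin n) ℝ => a.1 j k := fun k => (measurable_entry j k).comp measurable_fst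
  have hW : ∀ k, Measurable fun a : Matrix (Fin N) (Fin n) ℝ × (Fin N → Bool) ×
      Matrix (Fin n) (Fin n) ℝ => a.2.2 k i := fun k =>
    (measurable_entry k i).comp (measurable_snd.comp measurable_snd)
  have hm : MeasurableSet {a : Matrix (Fin N) (Fin n) ℝ × (Fin N → Bool) ×
      Matrix (Fin n) (Fin n) ℝ | a.2.1 j = true} :=
    measurableSet_eq_fun ((measurable_pi_apply j).comp (measurable_fst.comp measurable_snd))
      measurable_const
  simp only [mixed_apply]
  exact Measurable.ite hm (Finset.measurable_sum _ fun k _ => (h k).mul (hW k)) (h i)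

theorem measurable_step [∀ i, MeasurableSpace (Ξ i)]
    (hF : ∀ i, Measurable fun a : EuclideanSpace ℝ (Fin N) × Ξ i => lossGradient F i a.1 a.2) :
    Measurable fun a : (Matrix (Fin N) (Fin n) ℝ × (Fin N → Bool) × Matrix (Fin n) (Fin n) ℝ)
      × (∀ i, Ξ i) => step F γ a.1.1 a.1.2.1 a.1.2.2 a.2 := by
  refine measurable_pi_iff.2 fun j => measurable_pi_iff.2 fun i => ?_
  have h1 : Measurable fun a : (Matrix (Fin N) (Fin n) ℝ × (Fin N → Bool) ×
      Matrix (Fin n) (Fin n) ℝ) × (∀ i, Ξ i) => mixed a.1.1 a.1.2.1 a.1.2.2 j i :=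
    (measurable_entry j i).comp (measurable_mixed.comp measurable_fst)
  have h2 : Measurable fun a : (Matrix (Fin N) (Fin n) ℝ × (Fin N → Bool) ×
      Matrix (Fin n) (Fin n) ℝ) × (∀ i, Ξ i) => lossGradient F i (column a.1.1 i) (a.2 i) :=
    (hF i).comp (((measurable_column i).comp (measurable_fst.comp measurable_fst)).prodMk
      ((measurable_pi_apply i).comp measurable_snd))
  have h3 : Measurable fun a : (Matrix (Fin N) (Fin n) ℝ × (Fin N → Bool) ×
      Matrix (Fin n) (Fin n) ℝ) × (∀ i, Ξ i) => lossGradient F i (column a.1.1 i) (a.2 i) j := by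
    fun_prop
  exact h1.sub (h3.const_mul γ)

end Mixing

/-! ### The sigma-algebras generated by sets of random inputs -/

section Sources

variable {N n : ℕ} {Ω : Type*} {Ξ : Fin n → Type*} [∀ i, MeasurableSpace (Ξ i)]
  {W : ℕ → Ω → Matrix (Fin n) (Fin n) ℝ} {m : ℕ → Fin N → Ω → Bool} {ξ : ℕ → ∀ i, Ω → Ξ i}

/-- The iteration at which a random input is drawn. -/
def Source.time : Source N n → ℕ
  | .gossip t => t
  | .mask t _ => t
  | .sample t _ => t

/-- The sigma-algebra generated by a set of random inputs. -/
@[reducible]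
def sigmaOf (W : ℕ → Ω → Matrix (Fin n) (Fin n) ℝ) (m : ℕ → Fin N → Ω → Bool)
    (ξ : ℕ → ∀ i, Ω → Ξ i) (S : Set (Source N n)) : MeasurableSpace Ω :=
  ⨆ s ∈ S, sourceAlgebra W m ξ s

theorem sigmaOf_mono {S T : Set (Source N n)} (h : S ⊆ T) :
    sigmaOf W m ξ S ≤ sigmaOf W m ξ T := biSup_mono fun _ hs => h hs

theorem sourceAlgebra_le_sigmaOf {S : Set (Source N n)} {s : Source N n} (hs : s ∈ S) :
    sourceAlgebra W m ξ s ≤ sigmaOf W m ξ S := le_biSup (sourceAlgebra W m ξ) hs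

theorem measurable_gossip {S : Set (Source N n)} {t : ℕ} (h : .gossip t ∈ S) :
    Measurable[sigmaOf W m ξ S] (W t) :=
  measurable_iff_comap_le.2 (sourceAlgebra_le_sigmaOf h)

theorem measurable_mask {S : Set (Source N n)} {t : ℕ} {j : Fin N} (h : .mask t j ∈ S) :
    Measurable[sigmaOf W m ξ S] (m t j) :=
  measurable_iff_comap_le.2 (sourceAlgebra_le_sigmaOf h)

theorem measurable_sample {S : Set (Source N n)} {t : ℕ} {i : Fin n} (h : .sample t i ∈ S) :
    Measurable[sigmaOf W m ξ S] (ξ t i) :=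
  measurable_iff_comap_le.2 (sourceAlgebra_le_sigmaOf h)

/-- Adaptedness: the models at time `t` involve only inputs drawn strictly earlier, and are
therefore independent of those drawn at time `t`. -/
theorem measurable_iterates {F : ∀ i, EuclideanSpace ℝ (Fin N) → Ξ i → ℝ} (γ : ℝ)
    (X₀ : Matrix (Fin N) (Fin n) ℝ)
    (hF : ∀ i, Measurable fun a : EuclideanSpace ℝ (Fin N) × Ξ i => lossGradient F i a.1 a.2)
    (t : ℕ) : Measurable[sigmaOf W m ξ {s | s.time < t}] (iterates F γ X₀ W m ξ t) := by
  induction t with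
  | zero => exact measurable_const
  | succ t ih =>
    have h1 : Measurable[sigmaOf W m ξ {s | s.time < t + 1}] (iterates F γ X₀ W m ξ t) :=
      ih.mono (sigmaOf_mono fun s hs => Nat.lt_succ_of_lt hs) le_rfl
    have h2 : Measurable[sigmaOf W m ξ {s | s.time < t + 1}] (fun ω j => m t j ω) :=
      (@measurable_pi_iff _ _ _ (sigmaOf W m ξ _) _ _).2 fun j => measurable_mask (Nat.lt_succ_self t)
    have h3 : Measurable[sigmaOf W m ξ {s | s.time < t + 1}] (W t) :=
      measurable_gossip (Nat.lt_succ_self t)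
    have h4 : Measurable[sigmaOf W m ξ {s | s.time < t + 1}] (fun ω i => ξ t i ω) :=
      (@measurable_pi_iff _ _ _ (sigmaOf W m ξ _) _ _).2 fun i =>
        measurable_sample (Nat.lt_succ_self t)
    exact (measurable_step hF).comp ((h1.prodMk (h2.prodMk h3)).prodMk h4)

variable [MeasurableSpace Ω] {P : Measure Ω}

theorem sourceAlgebra_le (hW : ∀ t, Measurable (W t)) (hm : ∀ t j, Measurable (m t j))
    (hξ : ∀ t i, Measurable (ξ t i)) (s : Source N n) :
    sourceAlgebra W m ξ s ≤ ‹MeasurableSpace Ω› := by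
  cases s with
  | gossip t => exact (hW t).comap_le
  | mask t j => exact (hm t j).comap_le
  | sample t i => exact (hξ t i).comap_le

theorem sigmaOf_le (hW : ∀ t, Measurable (W t)) (hm : ∀ t j, Measurable (m t j))
    (hξ : ∀ t i, Measurable (ξ t i)) (S : Set (Source N n)) :
    sigmaOf W m ξ S ≤ ‹MeasurableSpace Ω› :=
  iSup₂_le fun s _ => sourceAlgebra_le hW hm hξ s

theorem indep_sigmaOf (hW : ∀ t, Measurable (W t)) (hm : ∀ t j, Measurable (m t j))
    (hξ : ∀ t i, Measurable (ξ t i)) (h : iIndep (sourceAlgebra W m ξ) P)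
    {S T : Set (Source N n)} (hST : Disjoint S T) :
    Indep (sigmaOf W m ξ S) (sigmaOf W m ξ T) P :=
  indep_iSup_of_disjoint (sourceAlgebra_le hW hm hξ) h hST

end Sources

/-! ### The objectives -/

section Objective

variable {N n : ℕ} {Ξ : Fin n → Type*} [∀ i, MeasurableSpace (Ξ i)] {D : ∀ i, Measure (Ξ i)}
  {F : ∀ i, EuclideanSpace ℝ (Fin N) → Ξ i → ℝ} {L : ℝ}

theorem hasGradientAt_objective (hf : ∀ i, Differentiable ℝ (localObjective D F i))
    (x : EuclideanSpace ℝ (Fin N)) :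
    HasGradientAt (objective D F)
      ((1 / (n : ℝ)) • ∑ i, gradient (localObjective D F i) x) x := by
  rw [hasGradientAt_iff_hasFDerivAt]
  have h : HasFDerivAt (fun x => 1 / (n : ℝ) * ∑ i, localObjective D F i x)
      ((1 / (n : ℝ)) • ∑ i, fderiv ℝ (localObjective D F i) x) x :=
    (HasFDerivAt.fun_sum fun i _ => (hf i x).hasFDerivAt).const_mul _
  convert! h using 1
  simp only [map_smul, map_sum, toDual_gradient]

theorem differentiable_objective (hf : ∀ i, Differentiable ℝ (localObjective D F i)) :
    Differentiable ℝ (objective D F) := fun x => (hasGradientAt_objective hf x).differentiableAt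

theorem gradient_objective (hf : ∀ i, Differentiable ℝ (localObjective D F i))
    (x : EuclideanSpace ℝ (Fin N)) :
    gradient (objective D F) x = (1 / (n : ℝ)) • ∑ i, gradient (localObjective D F i) x :=
  (hasGradientAt_objective hf x).gradient

theorem norm_gradient_objective_sub_le (hn : n ≠ 0)
    (hf : ∀ i, Differentiable ℝ (localObjective D F i))
    (hlip : ∀ i x y, ‖gradient (localObjective D F i) x - gradient (localObjective D F i) y‖
      ≤ L * ‖x - y‖) (x y : EuclideanSpace ℝ (Fin N)) :
    ‖gradient (objective D F) x - gradient (objective D F) y‖ ≤ L * ‖x - y‖ := by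
  have hn' : (0 : ℝ) < n := Nat.cast_pos.2 (Nat.pos_of_ne_zero hn)
  rw [gradient_objective hf, gradient_objective hf, ← smul_sub, ← Finset.sum_sub_distrib,
    norm_smul, Real.norm_of_nonneg (by positivity)]
  calc _ ≤ 1 / (n : ℝ) * ∑ _i : Fin n, L * ‖x - y‖ := by
        gcongr
        exact (norm_sum_le _ _).trans (Finset.sum_le_sum fun i _ => hlip i x y)
    _ = _ := by simp; field_simp

end Objective

/-! ### Moments of the iterates -/

section Iterates

variable {N n : ℕ} {Ξ : Fin n → Type*} [∀ i, MeasurableSpace (Ξ i)] {D : ∀ i, Measure (Ξ i)}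
  {F : ∀ i, EuclideanSpace ℝ (Fin N) → Ξ i → ℝ} {L σ ζ fstar : ℝ}
  {Ω : Type*} [MeasurableSpace Ω] {P : Measure Ω}
  {W : ℕ → Ω → Matrix (Fin n) (Fin n) ℝ} {m : ℕ → Fin N → Ω → Bool} {ξ : ℕ → ∀ i, Ω → Ξ i}
  {p ρ : ℝ} {hn : 2 ≤ n}

/-- The standing assumptions on the losses and on the random inputs. -/
structure Assumptions (hn : 2 ≤ n) (D : ∀ i, Measure (Ξ i))
    (F : ∀ i, EuclideanSpace ℝ (Fin N) → Ξ i → ℝ) (L σ ζ fstar : ℝ) (P : Measure Ω)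
    (W : ℕ → Ω → Matrix (Fin n) (Fin n) ℝ) (m : ℕ → Fin N → Ω → Bool) (ξ : ℕ → ∀ i, Ω → Ξ i)
    (p ρ : ℝ) : Prop where
  measurable_lossGradient : ∀ i, Measurable fun a : EuclideanSpace ℝ (Fin N) × Ξ i =>
    lossGradient F i a.1 a.2
  lipschitz_nonneg : 0 ≤ L
  differentiable : ∀ i, Differentiable ℝ (localObjective D F i)
  lipschitz : ∀ i x y, ‖gradient (localObjective D F i) x
    - gradient (localObjective D F i) y‖ ≤ L * ‖x - y‖
  unbiased : ∀ i x, Integrable (lossGradient F i x) (D i) ∧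
    ∫ z, lossGradient F i x z ∂(D i) = gradient (localObjective D F i) x
  variance_le : ∀ i x,
    Integrable (fun z => ‖lossGradient F i x z - gradient (localObjective D F i) x‖ ^ 2) (D i) ∧
    ∫ z, ‖lossGradient F i x z - gradient (localObjective D F i) x‖ ^ 2 ∂(D i) ≤ σ ^ 2
  deviation_le : ∀ x, (1 / (n : ℝ)) * ∑ i, ‖gradient (localObjective D F i) x
    - gradient (objective D F) x‖ ^ 2 ≤ ζ ^ 2
  lower_bound : ∀ x, fstar ≤ objective D F x
  measurable_W : ∀ t, Measurable (W t)
  measurable_m : ∀ t j, Measurable (m t j)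
  measurable_ξ : ∀ t i, Measurable (ξ t i)
  indep : iIndep (sourceAlgebra W m ξ) P
  law_ξ : ∀ t i, P.map (ξ t i) = D i
  p_nonneg : 0 ≤ p
  law_m : ∀ t j, P {ω | m t j ω = true} = ENNReal.ofReal p
  doublyStochastic_W : ∀ t, ∀ᵐ ω ∂P, W t ω ∈ doublyStochastic ℝ (Fin n)
  eigenvalue : ∀ t, secondLargestEigenvalue hn (gossipSecondMoment_isHermitian P (W t)) = ρ
  eigenvalue_lt : ρ < 1

/-- The deviation of the stochastic gradient of worker `i` from its mean. -/
noncomputable def noise (D : ∀ i, Measure (Ξ i)) (F : ∀ i, EuclideanSpace ℝ (Fin N) → Ξ i → ℝ)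
    (X : Matrix (Fin N) (Fin n) ℝ) (z : ∀ i, Ξ i) (i : Fin n) : EuclideanSpace ℝ (Fin N) :=
  lossGradient F i (column X i) (z i) - gradient (localObjective D F i) (column X i)

theorem continuous_of_norm_sub_le {E : Type*} [NormedAddCommGroup E] {G : E → E} {K : ℝ}
    (h : ∀ x y, ‖G x - G y‖ ≤ K * ‖x - y‖) : Continuous G :=
  (LipschitzWith.of_dist_le_mul (K := K.toNNReal) fun x y => by
    rw [dist_eq_norm, dist_eq_norm]
    exact (h x y).trans (mul_le_mul_of_nonneg_right (Real.le_coe_toNNReal K)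
      (norm_nonneg _))).continuous

/-- A Lipschitz map grows at most linearly, and constants are square integrable for a finite
measure. -/
theorem memLp_comp_of_norm_sub_le [IsFiniteMeasure P] {E : Type*} [NormedAddCommGroup E] {G : E → E}
    {K : ℝ} (h : ∀ x y, ‖G x - G y‖ ≤ K * ‖x - y‖) {x : Ω → E} (hx : MemLp x 2 P) :
    MemLp (fun ω => G (x ω)) 2 P := by
  have hb : MemLp (fun ω => K * ‖x ω‖ + ‖G 0‖) 2 P := (hx.norm.const_mul K).add (memLp_const _)
  refine hb.mono' ((continuous_of_norm_sub_le h).comp_aestronglyMeasurable hx.1)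
    (Filter.Eventually.of_forall fun ω => ?_)
  have h1 := h (x ω) 0
  rw [sub_zero] at h1
  have h2 := norm_add_le (G (x ω) - G 0) (G 0)
  rw [sub_add_cancel] at h2
  linarith

namespace Assumptions

theorem continuous_gradient (S : Assumptions hn D F L σ ζ fstar P W m ξ p ρ) (i : Fin n) :
    Continuous (gradient (localObjective D F i)) := continuous_of_norm_sub_le (S.lipschitz i)

theorem objective_lipschitz (S : Assumptions hn D F L σ ζ fstar P W m ξ p ρ)
    (x y : EuclideanSpace ℝ (Fin N)) :
    ‖gradient (objective D F) x - gradient (objective D F) y‖ ≤ L * ‖x - y‖ :=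
  norm_gradient_objective_sub_le (by omega) S.differentiable S.lipschitz x y

theorem measurable_iterates_ambient (S : Assumptions hn D F L σ ζ fstar P W m ξ p ρ) (γ : ℝ)
    (X₀ : Matrix (Fin N) (Fin n) ℝ) (t : ℕ) : Measurable (iterates F γ X₀ W m ξ t) :=
  (measurable_iterates γ X₀ S.measurable_lossGradient t).mono
    (sigmaOf_le S.measurable_W S.measurable_m S.measurable_ξ _) le_rfl

/-- The sigma-algebra of all inputs except one sample is large enough to contain the current models,
masks, gossip matrices and the other workers' noises at once, yet is independent of that sample. All
orthogonality relations of the noise are tested against it. -/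
theorem measurable_iterates_compl (S : Assumptions hn D F L σ ζ fstar P W m ξ p ρ) (γ : ℝ)
    (X₀ : Matrix (Fin N) (Fin n) ℝ) (t : ℕ) (i : Fin n) :
    Measurable[sigmaOf W m ξ {.sample t i}ᶜ] (iterates F γ X₀ W m ξ t) :=
  (measurable_iterates γ X₀ S.measurable_lossGradient t).mono
    (sigmaOf_mono fun s hs h => by
      rw [Set.mem_singleton_iff] at h
      rw [h] at hs
      exact lt_irrefl t hs) le_rfl

theorem measurable_noise (S : Assumptions hn D F L σ ζ fstar P W m ξ p ρ) (γ : ℝ)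
    (X₀ : Matrix (Fin N) (Fin n) ℝ) (t : ℕ) {i k : Fin n} (hki : k ≠ i) :
    Measurable[sigmaOf W m ξ {.sample t i}ᶜ]
      (fun ω => noise D F (iterates F γ X₀ W m ξ t ω) (fun i => ξ t i ω) k) := by
  have hX := (measurable_column k).comp (S.measurable_iterates_compl γ X₀ t i)
  have hz : Measurable[sigmaOf W m ξ {.sample t i}ᶜ] (ξ t k) :=
    measurable_sample (by simpa using hki)
  exact ((S.measurable_lossGradient k).comp (hX.prodMk hz)).sub
    ((S.continuous_gradient k).measurable.comp hX)

theorem measurable_mixed_compl (S : Assumptions hn D F L σ ζ fstar P W m ξ p ρ) (γ : ℝ)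
    (X₀ : Matrix (Fin N) (Fin n) ℝ) (t : ℕ) (i : Fin n) :
    Measurable[sigmaOf W m ξ {.sample t i}ᶜ]
      (fun ω => mixed (iterates F γ X₀ W m ξ t ω) (fun j => m t j ω) (W t ω)) := by
  have hX := S.measurable_iterates_compl γ X₀ t i
  have hm : Measurable[sigmaOf W m ξ {.sample t i}ᶜ] (fun ω j => m t j ω) :=
    (@measurable_pi_iff _ _ _ (sigmaOf W m ξ _) _ _).2 fun j => measurable_mask (by simp)
  have hW : Measurable[sigmaOf W m ξ {.sample t i}ᶜ] (W t) := measurable_gossip (by simp)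
  exact measurable_mixed.comp (hX.prodMk (hm.prodMk hW))

theorem measurable_mixed_ambient (S : Assumptions hn D F L σ ζ fstar P W m ξ p ρ) (γ : ℝ)
    (X₀ : Matrix (Fin N) (Fin n) ℝ) (t : ℕ) :
    Measurable (fun ω => mixed (iterates F γ X₀ W m ξ t ω) (fun j => m t j ω) (W t ω)) :=
  (S.measurable_mixed_compl γ X₀ t ⟨0, by omega⟩).mono
    (sigmaOf_le S.measurable_W S.measurable_m S.measurable_ξ _) le_rfl

theorem memLp_mixed (S : Assumptions hn D F L σ ζ fstar P W m ξ p ρ) {γ : ℝ}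
    {X₀ : Matrix (Fin N) (Fin n) ℝ} {t : ℕ}
    (h : ∀ i, MemLp (fun ω => column (iterates F γ X₀ W m ξ t ω) i) 2 P) (i : Fin n) :
    MemLp (fun ω => column (mixed (iterates F γ X₀ W m ξ t ω) (fun j => m t j ω) (W t ω)) i)
      2 P := by
  refine MemLp.of_eval_piLp fun j => ?_
  have hb : MemLp (fun ω => ∑ k, ‖iterates F γ X₀ W m ξ t ω j k‖) 2 P :=
    memLp_finsetSum _ fun k _ => ((h k).eval_piLp j).norm
  refine hb.mono' ((measurable_entry j i).comp
    (S.measurable_mixed_ambient γ X₀ t)).aestronglyMeasurable ?_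
  filter_upwards [S.doublyStochastic_W t] with ω hω
  exact norm_mixed_apply_le _ _ hω j i

variable [IsProbabilityMeasure P] [∀ i, IsProbabilityMeasure (D i)]

theorem integral_inner_noise (S : Assumptions hn D F L σ ζ fstar P W m ξ p ρ) (γ : ℝ)
    (X₀ : Matrix (Fin N) (Fin n) ℝ) (t : ℕ) (i : Fin n) {φ : Ω → EuclideanSpace ℝ (Fin N)}
    (hφ : Measurable[sigmaOf W m ξ {.sample t i}ᶜ] φ) :
    ∫ ω, inner ℝ (φ ω) (noise D F (iterates F γ X₀ W m ξ t ω) (fun i => ξ t i ω) i) ∂P = 0 := by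
  have hX := (measurable_column i).comp (S.measurable_iterates_compl γ X₀ t i)
  have hle := sigmaOf_le S.measurable_W S.measurable_m S.measurable_ξ {.sample t i}ᶜ
  have hz : Measurable[sigmaOf W m ξ {.sample t i}] (ξ t i) := measurable_sample rfl
  exact integral_inner_noise_eq_zero (S.measurable_ξ t i) (hX.mono hle le_rfl)
    (hφ.mono hle le_rfl) (S.measurable_lossGradient i) (S.continuous_gradient i).measurable
    (S.law_ξ t i)
    (Indep.indepFun_of_measurable (indep_sigmaOf S.measurable_W S.measurable_m S.measurable_ξ
      S.indep disjoint_compl_left) (hφ.prodMk hX) hz) (S.unbiased i)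

theorem memLp_noise (S : Assumptions hn D F L σ ζ fstar P W m ξ p ρ) (γ : ℝ)
    (X₀ : Matrix (Fin N) (Fin n) ℝ) (t : ℕ) (i : Fin n) :
    MemLp (fun ω => noise D F (iterates F γ X₀ W m ξ t ω) (fun i => ξ t i ω) i) 2 P ∧
    ∫ ω, ‖noise D F (iterates F γ X₀ W m ξ t ω) (fun i => ξ t i ω) i‖ ^ 2 ∂P ≤ σ ^ 2 := by
  have hX := (measurable_column i).comp (S.measurable_iterates_compl γ X₀ t i)
  have hle := sigmaOf_le S.measurable_W S.measurable_m S.measurable_ξ {.sample t i}ᶜ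
  have hz : Measurable[sigmaOf W m ξ {.sample t i}] (ξ t i) := measurable_sample rfl
  exact SAPS.memLp_noise (S.measurable_ξ t i) (hX.mono hle le_rfl) (S.measurable_lossGradient i)
    (S.continuous_gradient i).measurable (S.law_ξ t i)
    (Indep.indepFun_of_measurable (indep_sigmaOf S.measurable_W S.measurable_m S.measurable_ξ
      S.indep disjoint_compl_left) hX hz) (S.variance_le i)

/-- The noises of distinct workers are orthogonal in `L²`, so only the `n` diagonal terms of the
expanded square survive. This is the source of the speed-up in `n`. -/
theorem integral_sq_norm_mean_noise (S : Assumptions hn D F L σ ζ fstar P W m ξ p ρ) (γ : ℝ)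
    (X₀ : Matrix (Fin N) (Fin n) ℝ) (t : ℕ) :
    ∫ ω, ‖(1 / (n : ℝ)) • ∑ i, noise D F (iterates F γ X₀ W m ξ t ω) (fun i => ξ t i ω) i‖ ^ 2 ∂P
      ≤ σ ^ 2 / n := by
  set ε : Fin n → Ω → EuclideanSpace ℝ (Fin N) :=
    fun i ω => noise D F (iterates F γ X₀ W m ξ t ω) (fun i => ξ t i ω) i with hε
  have hL : ∀ i, MemLp (ε i) 2 P := fun i => (S.memLp_noise γ X₀ t i).1
  have hexp : ∀ ω, ‖(1 / (n : ℝ)) • ∑ i, ε i ω‖ ^ 2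
      = (1 / (n : ℝ)) ^ 2 * ∑ i, ∑ k, inner ℝ (ε i ω) (ε k ω) := by
    intro ω
    rw [norm_smul, mul_pow, ← real_inner_self_eq_norm_sq (∑ i, ε i ω), sum_inner]
    simp only [inner_sum, Real.norm_eq_abs, sq_abs]
  have horth : ∀ i k, i ≠ k → ∫ ω, inner ℝ (ε i ω) (ε k ω) ∂P = 0 := fun i k hik =>
    S.integral_inner_noise γ X₀ t k (S.measurable_noise γ X₀ t hik)
  have hn' : (0 : ℝ) < n := by exact_mod_cast (by omega : 0 < n)
  calc ∫ ω, ‖(1 / (n : ℝ)) • ∑ i, ε i ω‖ ^ 2 ∂P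
      = (1 / (n : ℝ)) ^ 2 * ∑ i, ∑ k, ∫ ω, inner ℝ (ε i ω) (ε k ω) ∂P := by
        simp only [hexp]
        rw [integral_const_mul, integral_finsetSum _ fun i _ => integrable_finsetSum _ fun k _ =>
          memLp_integrable_inner (hL i) (hL k)]
        congr 1
        exact Finset.sum_congr rfl fun i _ => integral_finsetSum _ fun k _ =>
          memLp_integrable_inner (hL i) (hL k)
    _ = (1 / (n : ℝ)) ^ 2 * ∑ i, ∫ ω, ‖ε i ω‖ ^ 2 ∂P := by
        congr 1
        refine Finset.sum_congr rfl fun i _ => ?_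
        rw [Finset.sum_eq_single i (fun k _ hk => horth i k hk.symm) (by simp)]
        simp only [real_inner_self_eq_norm_sq]
    _ ≤ (1 / (n : ℝ)) ^ 2 * ∑ _i : Fin n, σ ^ 2 := by
        gcongr with i
        exact (S.memLp_noise γ X₀ t i).2
    _ = σ ^ 2 / n := by
        simp only [Finset.sum_const, Finset.card_univ, Fintype.card_fin, nsmul_eq_mul]
        field_simp

theorem memLp_column (S : Assumptions hn D F L σ ζ fstar P W m ξ p ρ) (γ : ℝ)
    (X₀ : Matrix (Fin N) (Fin n) ℝ) (t : ℕ) (i : Fin n) :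
    MemLp (fun ω => column (iterates F γ X₀ W m ξ t ω) i) 2 P := by
  induction t generalizing i with
  | zero => exact memLp_const (column X₀ i)
  | succ t ih =>
    have h1 := S.memLp_mixed ih i
    -- The stochastic gradient is split as noise plus exact gradient.
    have h2 := (S.memLp_noise γ X₀ t i).1.add (memLp_comp_of_norm_sub_le (S.lipschitz i) (ih i))
    refine (h1.sub (h2.const_smul γ)).congr_norm
      ((measurable_column i).comp (S.measurable_iterates_ambient γ X₀ (t + 1))).aestronglyMeasurable
      (Filter.Eventually.of_forall fun ω => ?_)
    simp [iterates, column_step, noise, -smul_add]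

theorem memLp_average (S : Assumptions hn D F L σ ζ fstar P W m ξ p ρ) (γ : ℝ)
    (X₀ : Matrix (Fin N) (Fin n) ℝ) (t : ℕ) :
    MemLp (fun ω => average (iterates F γ X₀ W m ξ t ω)) 2 P :=
  (memLp_finsetSum _ fun i _ => S.memLp_column γ X₀ t i).const_smul (1 / (n : ℝ))

theorem integrable_consensusErrorSq (S : Assumptions hn D F L σ ζ fstar P W m ξ p ρ) (γ : ℝ)
    (X₀ : Matrix (Fin N) (Fin n) ℝ) (t : ℕ) :
    Integrable (fun ω => consensusErrorSq (iterates F γ X₀ W m ξ t ω)) P := by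
  simp only [consensusErrorSq_eq]
  exact integrable_finsetSum _ fun i _ =>
    memLp_integrable_sq_norm ((S.memLp_column γ X₀ t i).sub (S.memLp_average γ X₀ t))

theorem memLp_gradient_average (S : Assumptions hn D F L σ ζ fstar P W m ξ p ρ) (γ : ℝ)
    (X₀ : Matrix (Fin N) (Fin n) ℝ) (t : ℕ) :
    MemLp (fun ω => gradient (objective D F) (average (iterates F γ X₀ W m ξ t ω))) 2 P :=
  memLp_comp_of_norm_sub_le S.objective_lipschitz (S.memLp_average γ X₀ t)

/-- The objective lies between the constant `fstar` and its quadratic upper bound at the origin. -/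
theorem integrable_objective (S : Assumptions hn D F L σ ζ fstar P W m ξ p ρ) (γ : ℝ)
    (X₀ : Matrix (Fin N) (Fin n) ℝ) (t : ℕ) :
    Integrable (fun ω => objective D F (average (iterates F γ X₀ W m ξ t ω))) P := by
  have hx := S.memLp_average γ X₀ t
  have hup : Integrable (fun ω => objective D F 0
      + inner ℝ (gradient (objective D F) 0) (average (iterates F γ X₀ W m ξ t ω))
      + L / 2 * ‖average (iterates F γ X₀ W m ξ t ω)‖ ^ 2) P :=
    ((integrable_const _).add (memLp_integrable_inner (memLp_const _) hx)).add
      ((memLp_integrable_sq_norm hx).const_mul _)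
  refine integrable_of_le_of_le (g₁ := fun _ => fstar) ?_
    (Filter.Eventually.of_forall fun ω => S.lower_bound _)
    (Filter.Eventually.of_forall fun ω => ?_) (integrable_const _) hup
  · exact (differentiable_objective S.differentiable).continuous.comp_aestronglyMeasurable hx.1
  · have h := le_quadratic_of_gradient_lipschitz (differentiable_objective S.differentiable)
      S.objective_lipschitz 0 (average (iterates F γ X₀ W m ξ t ω))
    rwa [zero_add] at h

end Assumptions

end Iterates

/-! ### One iteration in expectation -/

/-- The common shape of the pointwise bounds behind `descent` and `consensus_step`; there `g₄` is
the noise cross term, whose integral vanishes. -/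
theorem integral_le_of_ae_le_add_sub_add {Ω : Type*} [MeasurableSpace Ω] {P : Measure Ω}
    {f g₁ g₂ g₃ g₄ g₅ : Ω → ℝ} (hf : Integrable f P) (h₁ : Integrable g₁ P)
    (h₂ : Integrable g₂ P) (h₃ : Integrable g₃ P) (h₄ : Integrable g₄ P) (h₅ : Integrable g₅ P)
    (h : ∀ᵐ ω ∂P, f ω ≤ g₁ ω + g₂ ω + g₃ ω - g₄ ω + g₅ ω) :
    ∫ ω, f ω ∂P ≤ (∫ ω, g₁ ω ∂P) + (∫ ω, g₂ ω ∂P) + (∫ ω, g₃ ω ∂P) - (∫ ω, g₄ ω ∂P)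
      + ∫ ω, g₅ ω ∂P := by
  have h12 : Integrable (fun ω => g₁ ω + g₂ ω) P := h₁.add h₂
  have h123 : Integrable (fun ω => g₁ ω + g₂ ω + g₃ ω) P := h12.add h₃
  have h1234 : Integrable (fun ω => g₁ ω + g₂ ω + g₃ ω - g₄ ω) P := h123.sub h₄
  rw [← integral_add h₁ h₂, ← integral_add h12 h₃, ← integral_sub h123 h₄,
    ← integral_add h1234 h₅]
  exact integral_mono_ae hf (h1234.add h₅) h

section OneStep

variable {N n : ℕ} {Ξ : Fin n → Type*} [∀ i, MeasurableSpace (Ξ i)] {D : ∀ i, Measure (Ξ i)}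
  {F : ∀ i, EuclideanSpace ℝ (Fin N) → Ξ i → ℝ} {L σ ζ fstar : ℝ}
  {Ω : Type*} [MeasurableSpace Ω] {P : Measure Ω}
  {W : ℕ → Ω → Matrix (Fin n) (Fin n) ℝ} {m : ℕ → Fin N → Ω → Bool} {ξ : ℕ → ∀ i, Ω → Ξ i}
  {p ρ : ℝ} {hn : 2 ≤ n}

/-- The average over the workers of the local gradients at the local models. -/
noncomputable def meanGradient (D : ∀ i, Measure (Ξ i))
    (F : ∀ i, EuclideanSpace ℝ (Fin N) → Ξ i → ℝ) (X : Matrix (Fin N) (Fin n) ℝ) :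
    EuclideanSpace ℝ (Fin N) :=
  (1 / (n : ℝ)) • ∑ i, gradient (localObjective D F i) (column X i)

/-- The average over the workers of the stochastic gradient noise. -/
noncomputable def meanNoise (D : ∀ i, Measure (Ξ i))
    (F : ∀ i, EuclideanSpace ℝ (Fin N) → Ξ i → ℝ) (X : Matrix (Fin N) (Fin n) ℝ)
    (z : ∀ i, Ξ i) : EuclideanSpace ℝ (Fin N) :=
  (1 / (n : ℝ)) • ∑ i, noise D F X z i

theorem average_step_eq (X : Matrix (Fin N) (Fin n) ℝ) (m : Fin N → Bool)
    {W : Matrix (Fin n) (Fin n) ℝ} (hW : W ∈ doublyStochastic ℝ (Fin n)) (z : ∀ i, Ξ i) (γ : ℝ) :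
    average (step F γ X m W z)
      = average X + -(γ • (meanGradient D F X + meanNoise D F X z)) := by
  rw [average_step X m hW, meanGradient, meanNoise, ← smul_add, ← Finset.sum_add_distrib,
    sub_eq_add_neg]
  simp only [noise, add_sub_cancel]

namespace Assumptions

theorem sq_norm_gradient_sub_meanGradient_le (S : Assumptions hn D F L σ ζ fstar P W m ξ p ρ)
    (X : Matrix (Fin N) (Fin n) ℝ) :
    ‖gradient (objective D F) (average X) - meanGradient D F X‖ ^ 2
      ≤ L ^ 2 / n * consensusErrorSq X := by
  have h : gradient (objective D F) (average X) - meanGradient D F X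
      = (1 / (n : ℝ)) • ∑ i, (gradient (localObjective D F i) (average X)
        - gradient (localObjective D F i) (column X i)) := by
    rw [gradient_objective S.differentiable, meanGradient, Finset.sum_sub_distrib, smul_sub]
  rw [h]
  refine (sq_norm_mean_le _).trans ?_
  rw [consensusErrorSq_eq, one_div_mul_eq_div, div_mul_eq_mul_div, Finset.mul_sum]
  gcongr with i
  rw [← mul_pow, norm_sub_rev (column X i)]
  exact pow_le_pow_left₀ (norm_nonneg _) (S.lipschitz i _ _) 2

/-- With `g` the global gradient at the average and `h` the mean local gradient, the polarisation
`2⟨g, h⟩ = ‖g‖ ^ 2 + ‖h‖ ^ 2 - ‖g - h‖ ^ 2` yields the gain, and `‖g - h‖ ^ 2` is bounded by the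
consensus error. The remaining multiple of `‖h‖ ^ 2` has the good sign because `L * γ ≤ 1`. The
terms linear in the noise are gathered in one inner product. -/
theorem objective_average_step_le (S : Assumptions hn D F L σ ζ fstar P W m ξ p ρ) {γ : ℝ}
    (hγ : 0 < γ) (hLγ : L * γ ≤ 1) (X : Matrix (Fin N) (Fin n) ℝ) (M : Fin N → Bool)
    {V : Matrix (Fin n) (Fin n) ℝ} (hV : V ∈ doublyStochastic ℝ (Fin n)) (z : ∀ i, Ξ i) :
    objective D F (average (step F γ X M V z))
      ≤ objective D F (average X) - γ / 2 * ‖gradient (objective D F) (average X)‖ ^ 2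
        + γ * L ^ 2 / (2 * n) * consensusErrorSq X
        - inner ℝ (γ • gradient (objective D F) (average X) - (L * γ ^ 2) • meanGradient D F X)
          (meanNoise D F X z)
        + L * γ ^ 2 / 2 * ‖meanNoise D F X z‖ ^ 2 := by
  rw [average_step_eq X M hV z γ (D := D)]
  have h := le_quadratic_of_gradient_lipschitz (differentiable_objective S.differentiable)
    S.objective_lipschitz (average X) (-(γ • (meanGradient D F X + meanNoise D F X z)))
  have h2 := S.sq_norm_gradient_sub_meanGradient_le X
  rw [norm_neg, norm_smul, mul_pow, Real.norm_eq_abs, sq_abs, norm_add_sq_real, inner_neg_right,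
    real_inner_smul_right, inner_add_right] at h
  rw [norm_sub_sq_real] at h2
  rw [inner_sub_left, real_inner_smul_left, real_inner_smul_left]
  have h3 : γ * L ^ 2 / (2 * n) * consensusErrorSq X
      = γ / 2 * (L ^ 2 / n * consensusErrorSq X) := by ring
  rw [h3]
  have h4 := mul_le_mul_of_nonneg_left h2 (by positivity : 0 ≤ γ / 2)
  have h5 : 0 ≤ γ / 2 * (1 - L * γ) * ‖meanGradient D F X‖ ^ 2 := by
    have : 0 ≤ 1 - L * γ := by linarith
    positivity
  linarith

/-- A bound for the deviation from consensus after replacing the models `X` by `M` and taking a step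
along the exact local gradients. -/
theorem sum_sq_norm_drift_le (S : Assumptions hn D F L σ ζ fstar P W m ξ p ρ) {γ : ℝ}
    (X M : Matrix (Fin N) (Fin n) ℝ) {α β κ : ℝ} (hα : 0 < α) (hβ : 0 < β) (hκ : 0 < κ)
    (h : α + β + κ = 1) :
    ∑ i, ‖column M i - average X
        - γ • (gradient (localObjective D F i) (column X i) - meanGradient D F X)‖ ^ 2
      ≤ 1 / α * ∑ i, ‖column M i - average X‖ ^ 2
        + γ ^ 2 * L ^ 2 / β * consensusErrorSq X + γ ^ 2 * (n * ζ ^ 2) / κ := by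
  have hn' : (0 : ℝ) < n := by exact_mod_cast (by omega : 0 < n)
  set v : Fin n → EuclideanSpace ℝ (Fin N) := fun i =>
    gradient (localObjective D F i) (column X i) - gradient (localObjective D F i) (average X)
    with hv
  set w : Fin n → EuclideanSpace ℝ (Fin N) := fun i =>
    gradient (localObjective D F i) (average X) - gradient (objective D F) (average X) with hw
  have hdec : ∀ i, column M i - average X
      - γ • (gradient (localObjective D F i) (column X i) - meanGradient D F X)
      -- Here `v` measures the error of taking gradients at the local models instead of the average,
      -- and `w` the heterogeneity of the data. Centring `v` does not increase its sum of squares.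
      = (column M i - average X) + -(γ • (v i - (1 / (n : ℝ)) • ∑ k, v k)) + -(γ • w i) := by
    intro i
    have hmean : (1 / (n : ℝ)) • ∑ k, v k
        = meanGradient D F X - gradient (objective D F) (average X) := by
      rw [gradient_objective S.differentiable, meanGradient, ← smul_sub, ← Finset.sum_sub_distrib]
    rw [hmean]
    simp only [hv, hw]
    module
  have hvsum : ∑ i, ‖v i - (1 / (n : ℝ)) • ∑ k, v k‖ ^ 2 ≤ L ^ 2 * consensusErrorSq X := by
    refine (sum_sq_norm_sub_mean_le v).trans ?_
    rw [consensusErrorSq_eq, Finset.mul_sum]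
    refine Finset.sum_le_sum fun i _ => ?_
    rw [← mul_pow]
    exact pow_le_pow_left₀ (norm_nonneg _) (S.lipschitz i _ _) 2
  have hwsum : ∑ i, ‖w i‖ ^ 2 ≤ n * ζ ^ 2 := by
    have := S.deviation_le (average X)
    rwa [one_div, inv_mul_le_iff₀ hn'] at this
  calc _ ≤ ∑ i, (‖column M i - average X‖ ^ 2 / α
          + ‖-(γ • (v i - (1 / (n : ℝ)) • ∑ k, v k))‖ ^ 2 / β + ‖-(γ • w i)‖ ^ 2 / κ) := by
        refine Finset.sum_le_sum fun i _ => ?_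
        rw [hdec]
        exact sq_norm_add_add_le _ _ _ hα hβ hκ h
    _ = 1 / α * ∑ i, ‖column M i - average X‖ ^ 2
          + γ ^ 2 / β * ∑ i, ‖v i - (1 / (n : ℝ)) • ∑ k, v k‖ ^ 2
          + γ ^ 2 / κ * ∑ i, ‖w i‖ ^ 2 := by
        simp only [Finset.sum_add_distrib, norm_neg, norm_smul, mul_pow, Real.norm_eq_abs, sq_abs,
          Finset.mul_sum]
        congr 1
        · congr 1
          · exact Finset.sum_congr rfl fun i _ => by ring
          · exact Finset.sum_congr rfl fun i _ => by ring
        · exact Finset.sum_congr rfl fun i _ => by ring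
    _ ≤ 1 / α * ∑ i, ‖column M i - average X‖ ^ 2
          + γ ^ 2 / β * (L ^ 2 * consensusErrorSq X) + γ ^ 2 / κ * (n * ζ ^ 2) := by
        gcongr
    _ = _ := by ring

theorem measurable_meanGradient (S : Assumptions hn D F L σ ζ fstar P W m ξ p ρ) :
    Measurable fun X : Matrix (Fin N) (Fin n) ℝ => meanGradient D F X :=
  (Finset.measurable_sum _ fun i _ =>
    (S.continuous_gradient i).measurable.comp (measurable_column i)).const_smul (1 / (n : ℝ))

variable [IsProbabilityMeasure P] [∀ i, IsProbabilityMeasure (D i)]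

theorem memLp_meanGradient (S : Assumptions hn D F L σ ζ fstar P W m ξ p ρ) (γ : ℝ)
    (X₀ : Matrix (Fin N) (Fin n) ℝ) (t : ℕ) :
    MemLp (fun ω => meanGradient D F (iterates F γ X₀ W m ξ t ω)) 2 P :=
  (memLp_finsetSum _ fun i _ => memLp_comp_of_norm_sub_le (S.lipschitz i)
    (S.memLp_column γ X₀ t i)).const_smul (1 / (n : ℝ))

theorem memLp_meanNoise (S : Assumptions hn D F L σ ζ fstar P W m ξ p ρ) (γ : ℝ)
    (X₀ : Matrix (Fin N) (Fin n) ℝ) (t : ℕ) :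
    MemLp (fun ω => meanNoise D F (iterates F γ X₀ W m ξ t ω) (fun i => ξ t i ω)) 2 P :=
  (memLp_finsetSum _ fun i _ => (S.memLp_noise γ X₀ t i).1).const_smul (1 / (n : ℝ))

theorem integral_inner_meanNoise (S : Assumptions hn D F L σ ζ fstar P W m ξ p ρ) (γ : ℝ)
    (X₀ : Matrix (Fin N) (Fin n) ℝ) (t : ℕ) {φ : Ω → EuclideanSpace ℝ (Fin N)}
    (hφ : ∀ i, Measurable[sigmaOf W m ξ {.sample t i}ᶜ] φ) (hφL : MemLp φ 2 P) :
    ∫ ω, inner ℝ (φ ω)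
      (meanNoise D F (iterates F γ X₀ W m ξ t ω) (fun i => ξ t i ω)) ∂P = 0 := by
  simp only [meanNoise, real_inner_smul_right, inner_sum]
  rw [integral_const_mul, integral_finsetSum _ fun i _ =>
    memLp_integrable_inner hφL (S.memLp_noise γ X₀ t i).1,
    Finset.sum_eq_zero fun i _ => S.integral_inner_noise γ X₀ t i (hφ i), mul_zero]

theorem descent (S : Assumptions hn D F L σ ζ fstar P W m ξ p ρ) {γ : ℝ}
    (hγ : 0 < γ) (hLγ : L * γ ≤ 1) (X₀ : Matrix (Fin N) (Fin n) ℝ) (t : ℕ) :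
    γ / 2 * ∫ ω, ‖gradient (objective D F) (average (iterates F γ X₀ W m ξ t ω))‖ ^ 2 ∂P
      ≤ (∫ ω, objective D F (average (iterates F γ X₀ W m ξ t ω)) ∂P)
        - (∫ ω, objective D F (average (iterates F γ X₀ W m ξ (t + 1) ω)) ∂P)
        + γ * L ^ 2 / (2 * n) * (∫ ω, consensusErrorSq (iterates F γ X₀ W m ξ t ω) ∂P)
        + L * γ ^ 2 / 2 * (σ ^ 2 / n) := by
  set X := iterates F γ X₀ W m ξ t with hX
  set ψ : Matrix (Fin N) (Fin n) ℝ → EuclideanSpace ℝ (Fin N) := fun X =>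
    γ • gradient (objective D F) (average X) - (L * γ ^ 2) • meanGradient D F X with hψ
  have hψm : Measurable ψ :=
    (((continuous_of_norm_sub_le S.objective_lipschitz).measurable.comp
      measurable_average).const_smul γ).sub (S.measurable_meanGradient.const_smul (L * γ ^ 2))
  have hψL : MemLp (fun ω => ψ (X ω)) 2 P :=
    ((S.memLp_gradient_average γ X₀ t).const_smul γ).sub
      ((S.memLp_meanGradient γ X₀ t).const_smul (L * γ ^ 2))
  have hε := S.memLp_meanNoise γ X₀ t
  have h0 := S.integral_inner_meanNoise γ X₀ t
    (fun i => hψm.comp (S.measurable_iterates_compl γ X₀ t i)) hψL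
  have i1 := S.integrable_objective γ X₀ t
  have i2 := (memLp_integrable_sq_norm (S.memLp_gradient_average γ X₀ t)).const_mul (-(γ / 2))
  have i3 := (S.integrable_consensusErrorSq γ X₀ t).const_mul (γ * L ^ 2 / (2 * n))
  have i4 := memLp_integrable_inner hψL hε
  have i5 := (memLp_integrable_sq_norm hε).const_mul (L * γ ^ 2 / 2)
  have h := integral_le_of_ae_le_add_sub_add (S.integrable_objective γ X₀ (t + 1))
    i1 i2 i3 i4 i5 (by
      filter_upwards [S.doublyStochastic_W t] with ω hω
      rw [neg_mul, ← sub_eq_add_neg]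
      exact S.objective_average_step_le hγ hLγ (X ω) (fun j => m t j ω) hω (fun i => ξ t i ω))
  rw [integral_const_mul, integral_const_mul, integral_const_mul] at h
  have h5 := mul_le_mul_of_nonneg_left (S.integral_sq_norm_mean_noise γ X₀ t)
    (mul_nonneg S.lipschitz_nonneg (by positivity : 0 ≤ γ ^ 2 / 2))
  simp only [Function.comp_apply] at h0
  simp only [meanNoise] at h h0
  simp only [hX] at h h0 ⊢
  linarith

theorem measurable_row_sub_average (j : Fin N) :
    Measurable fun (M : Matrix (Fin N) (Fin n) ℝ) (i : Fin n) => M j i - average M j :=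
  measurable_pi_iff.2 fun i => (measurable_entry j i).sub ((by fun_prop : Measurable
    fun x : EuclideanSpace ℝ (Fin N) => x j).comp measurable_average)

/-- Only the bit of coordinate `j`, the gossip matrix and the past have to be independent; the rows
are afterwards added by linearity. -/
theorem integral_mixed_row_le (S : Assumptions hn D F L σ ζ fstar P W m ξ p ρ) (γ : ℝ)
    (X₀ : Matrix (Fin N) (Fin n) ℝ) (t : ℕ) (j : Fin N) :
    ∫ ω, ∑ i, (if m t j ω then
        ∑ k, (iterates F γ X₀ W m ξ t ω j k - average (iterates F γ X₀ W m ξ t ω) j) * W t ω k i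
        else iterates F γ X₀ W m ξ t ω j i - average (iterates F γ X₀ W m ξ t ω) j) ^ 2 ∂P
      ≤ (1 - p + p * ρ) * ∫ ω, ∑ i,
        (iterates F γ X₀ W m ξ t ω j i - average (iterates F γ X₀ W m ξ t ω) j) ^ 2 ∂P := by
  set Y : Ω → Fin n → ℝ := fun ω i =>
    iterates F γ X₀ W m ξ t ω j i - average (iterates F γ X₀ W m ξ t ω) j with hYdef
  have hind : ∀ {A B : Set (Source N n)}, Disjoint A B →
      Indep (sigmaOf W m ξ A) (sigmaOf W m ξ B) P := fun h =>
    indep_sigmaOf S.measurable_W S.measurable_m S.measurable_ξ S.indep h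
  have hYpast : Measurable[sigmaOf W m ξ {s | s.time < t}] Y :=
    (measurable_row_sub_average j).comp (measurable_iterates γ X₀ S.measurable_lossGradient t)
  have hYm : Measurable Y :=
    hYpast.mono (sigmaOf_le S.measurable_W S.measurable_m S.measurable_ξ _) le_rfl
  have hYL : ∀ i, MemLp (fun ω => Y ω i) 2 P := fun i =>
    ((S.memLp_column γ X₀ t i).sub (S.memLp_average γ X₀ t)).eval_piLp j
  have hbW : IndepFun (m t j) (W t) P :=
    Indep.indepFun_of_measurable (hind (A := {.mask t j}) (B := {.gossip t}) (by simp))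
      (measurable_mask rfl) (measurable_gossip rfl)
  have hpair : Measurable[sigmaOf W m ξ {.mask t j, .gossip t}] fun ω => (m t j ω, W t ω) :=
    (measurable_mask (by simp)).prodMk (measurable_gossip (by simp))
  have hdisj : Disjoint {s : Source N n | s.time < t} {.mask t j, .gossip t} := by
    rw [Set.disjoint_left]
    rintro s hs (h | h)
    · rw [h] at hs
      exact lt_irrefl t hs
    · rw [Set.mem_singleton_iff] at h
      rw [h] at hs
      exact lt_irrefl t hs
  have hY : IndepFun Y (fun ω => (m t j ω, W t ω)) P :=
    Indep.indepFun_of_measurable (hind hdisj) hYpast hpair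
  have hlt : secondLargestEigenvalue hn (gossipSecondMoment_isHermitian P (W t)) < 1 := by
    rw [S.eigenvalue t]
    exact S.eigenvalue_lt
  have hY0 : ∀ ω, ∑ i, Y ω i = 0 := fun ω => sum_sub_average (by omega) _ j
  have h := integral_masked_gossip_le hn (S.measurable_W t) (S.measurable_m t j)
    (S.doublyStochastic_W t) hlt hbW hY hYL hYm hY0 S.p_nonneg (S.law_m t j)
  rwa [S.eigenvalue t] at h

theorem integral_mixed_deviation_le (S : Assumptions hn D F L σ ζ fstar P W m ξ p ρ) (γ : ℝ)
    (X₀ : Matrix (Fin N) (Fin n) ℝ) (t : ℕ) :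
    ∫ ω, ∑ i, ‖column (mixed (iterates F γ X₀ W m ξ t ω) (fun j => m t j ω) (W t ω)) i
        - average (iterates F γ X₀ W m ξ t ω)‖ ^ 2 ∂P
      ≤ (1 - p + p * ρ) * ∫ ω, consensusErrorSq (iterates F γ X₀ W m ξ t ω) ∂P := by
  set X := iterates F γ X₀ W m ξ t with hX
  have hcol := S.memLp_column γ X₀ t
  have havg := S.memLp_average γ X₀ t
  have hmixL := S.memLp_mixed hcol
  have hae : (fun ω => ∑ i, ‖column (mixed (X ω) (fun j => m t j ω) (W t ω)) i
        - average (X ω)‖ ^ 2) =ᵐ[P] fun ω => ∑ j, ∑ i, (if m t j ω then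
        ∑ k, (X ω j k - average (X ω) j) * W t ω k i else X ω j i - average (X ω) j) ^ 2 := by
    filter_upwards [S.doublyStochastic_W t] with ω hω
    simp only [EuclideanSpace.real_norm_sq_eq, PiLp.sub_apply, column_apply,
      mixed_sub_average _ _ hω]
    exact Finset.sum_comm
  have hI : ∀ j, Integrable (fun ω => ∑ i, (if m t j ω then
        ∑ k, (X ω j k - average (X ω) j) * W t ω k i else X ω j i - average (X ω) j) ^ 2) P := by
    intro j
    refine (integrable_finsetSum Finset.univ fun i _ =>
      (((hmixL i).sub havg).eval_piLp j).integrable_sq).congr ?_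
    filter_upwards [S.doublyStochastic_W t] with ω hω
    simp only [Pi.sub_apply, PiLp.sub_apply, column_apply]
    exact Finset.sum_congr rfl fun i _ => by rw [mixed_sub_average _ _ hω]
  rw [integral_congr_ae hae, integral_finsetSum _ fun j _ => hI j]
  simp only [consensusErrorSq]
  have hJ : ∀ j, Integrable (fun ω => ∑ i, (X ω j i - average (X ω) j) ^ 2) P := fun j =>
    integrable_finsetSum _ fun i _ => (((hcol i).sub havg).eval_piLp j).integrable_sq
  rw [integral_finsetSum _ fun j _ => hJ j, Finset.mul_sum]
  exact Finset.sum_le_sum fun j _ => S.integral_mixed_row_le γ X₀ t j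

/-- The new deviation is a drift `a i`, which involves no sample of time `t`, minus the centred
noise. Their cross term has mean zero, so the noise enters with factor `1`, and the weights `α`,
`β`, `κ` are spent on the drift alone. -/
theorem consensus_step (S : Assumptions hn D F L σ ζ fstar P W m ξ p ρ) (γ : ℝ)
    (X₀ : Matrix (Fin N) (Fin n) ℝ) (t : ℕ) {α β κ : ℝ} (hα : 0 < α) (hβ : 0 < β) (hκ : 0 < κ)
    (h : α + β + κ = 1) :
    ∫ ω, consensusErrorSq (iterates F γ X₀ W m ξ (t + 1) ω) ∂P
      ≤ ((1 - p + p * ρ) / α + γ ^ 2 * L ^ 2 / β)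
          * (∫ ω, consensusErrorSq (iterates F γ X₀ W m ξ t ω) ∂P)
        + γ ^ 2 * (n * ζ ^ 2) / κ + γ ^ 2 * (n * σ ^ 2) := by
  set X := iterates F γ X₀ W m ξ t with hX
  set M : Ω → Matrix (Fin N) (Fin n) ℝ := fun ω => mixed (X ω) (fun j => m t j ω) (W t ω) with hM
  set ε : Fin n → Ω → EuclideanSpace ℝ (Fin N) :=
    fun i ω => noise D F (X ω) (fun i => ξ t i ω) i with hε
  set εb : Ω → EuclideanSpace ℝ (Fin N) :=
    fun ω => meanNoise D F (X ω) (fun i => ξ t i ω) with hεb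
  set a : Fin n → Ω → EuclideanSpace ℝ (Fin N) := fun i ω => column (M ω) i - average (X ω)
    - γ • (gradient (localObjective D F i) (column (X ω) i) - meanGradient D F (X ω)) with ha
  have hcol := S.memLp_column γ X₀ t
  have havg := S.memLp_average γ X₀ t
  have hεL : ∀ i, MemLp (ε i) 2 P := fun i => (S.memLp_noise γ X₀ t i).1
  have hεbL : MemLp εb 2 P := S.memLp_meanNoise γ X₀ t
  have huL : ∀ i, MemLp (fun ω => column (M ω) i - average (X ω)) 2 P := fun i =>
    (S.memLp_mixed hcol i).sub havg
  have haL : ∀ i, MemLp (a i) 2 P := fun i => (huL i).sub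
    (((memLp_comp_of_norm_sub_le (S.lipschitz i) (hcol i)).sub
      (S.memLp_meanGradient γ X₀ t)).const_smul γ)
  have ham : ∀ i k, Measurable[sigmaOf W m ξ {.sample t k}ᶜ] (a i) := by
    intro i k
    have hXk := S.measurable_iterates_compl γ X₀ t k
    exact (((measurable_column i).comp (S.measurable_mixed_compl γ X₀ t k)).sub
      (measurable_average.comp hXk)).sub
      (((((S.continuous_gradient i).measurable.comp (measurable_column i)).sub
        S.measurable_meanGradient).const_smul γ).comp hXk)
  have hcross : ∀ i, ∫ ω, inner ℝ (a i ω) (ε i ω - εb ω) ∂P = 0 := by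
    intro i
    simp only [inner_sub_right]
    rw [integral_sub (memLp_integrable_inner (haL i) (hεL i))
      (memLp_integrable_inner (haL i) hεbL),
      S.integral_inner_noise γ X₀ t i (ham i i),
      S.integral_inner_meanNoise γ X₀ t (ham i) (haL i), sub_zero]
  have hstep : ∀ᵐ ω ∂P, consensusErrorSq (iterates F γ X₀ W m ξ (t + 1) ω)
      = ∑ i, ‖a i ω - γ • (ε i ω - εb ω)‖ ^ 2 := by
    filter_upwards [S.doublyStochastic_W t] with ω hω
    rw [consensusErrorSq_eq]
    refine Finset.sum_congr rfl fun i _ => ?_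
    have h1 : column (iterates F γ X₀ W m ξ (t + 1) ω) i
        - average (iterates F γ X₀ W m ξ (t + 1) ω) = a i ω - γ • (ε i ω - εb ω) := by
      change column (step F γ (X ω) _ _ _) i - average (step F γ (X ω) _ _ _) = _
      rw [average_step_eq (X ω) _ hω _ γ (D := D), column_step]
      simp only [ha, hε, hεb, noise, hM]
      module
    rw [h1]
  have hbound : ∀ᵐ ω ∂P, consensusErrorSq (iterates F γ X₀ W m ξ (t + 1) ω)
      ≤ 1 / α * ∑ i, ‖column (M ω) i - average (X ω)‖ ^ 2
        + γ ^ 2 * L ^ 2 / β * consensusErrorSq (X ω) + γ ^ 2 * (n * ζ ^ 2) / κ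
        - 2 * γ * ∑ i, inner ℝ (a i ω) (ε i ω - εb ω) + γ ^ 2 * ∑ i, ‖ε i ω‖ ^ 2 := by
    filter_upwards [hstep] with ω hω
    rw [hω]
    have h1 := S.sum_sq_norm_drift_le (γ := γ) (X ω) (M ω) hα hβ hκ h
    have h2 := mul_le_mul_of_nonneg_left (sum_sq_norm_sub_mean_le fun i => ε i ω) (sq_nonneg γ)
    have h3 : ∑ i, ‖a i ω - γ • (ε i ω - εb ω)‖ ^ 2 = ∑ i, ‖a i ω‖ ^ 2
        - 2 * γ * ∑ i, inner ℝ (a i ω) (ε i ω - εb ω)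
        + γ ^ 2 * ∑ i, ‖ε i ω - εb ω‖ ^ 2 := by
      simp only [norm_sub_sq_real (a _ ω), real_inner_smul_right, norm_smul, mul_pow,
        Real.norm_eq_abs, sq_abs, Finset.mul_sum, ← Finset.sum_sub_distrib,
        ← Finset.sum_add_distrib]
      exact Finset.sum_congr rfl fun i _ => by ring
    rw [h3]
    change γ ^ 2 * ∑ i, ‖ε i ω - εb ω‖ ^ 2 ≤ _ at h2
    linarith
  have i1 : Integrable (fun ω => ∑ i, ‖column (M ω) i - average (X ω)‖ ^ 2) P :=
    integrable_finsetSum _ fun i _ => memLp_integrable_sq_norm (huL i)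
  have i2 := S.integrable_consensusErrorSq γ X₀ t
  have i4 : ∀ i, Integrable (fun ω => inner ℝ (a i ω) (ε i ω - εb ω)) P := fun i =>
    memLp_integrable_inner (haL i) ((hεL i).sub hεbL)
  have i5 : ∀ i, Integrable (fun ω => ‖ε i ω‖ ^ 2) P := fun i => memLp_integrable_sq_norm (hεL i)
  have j1 := i1.const_mul (1 / α)
  have j2 := i2.const_mul (γ ^ 2 * L ^ 2 / β)
  have j3 : Integrable (fun _ : Ω => γ ^ 2 * (n * ζ ^ 2) / κ) P := integrable_const _
  have j4 := (integrable_finsetSum Finset.univ fun i _ => i4 i).const_mul (2 * γ)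
  have j5 := (integrable_finsetSum Finset.univ fun i _ => i5 i).const_mul (γ ^ 2)
  have hint := integral_le_of_ae_le_add_sub_add (S.integrable_consensusErrorSq γ X₀ (t + 1))
    j1 j2 j3 j4 j5 hbound
  rw [integral_const_mul, integral_const_mul, integral_const_mul, integral_const_mul,
    integral_finsetSum _ fun i _ => i4 i, integral_finsetSum _ fun i _ => i5 i,
    Finset.sum_eq_zero fun i _ => hcross i] at hint
  have h1 := mul_le_mul_of_nonneg_left (S.integral_mixed_deviation_le γ X₀ t)
    (by positivity : 0 ≤ 1 / α)
  have h2 : γ ^ 2 * ∑ i, ∫ ω, ‖ε i ω‖ ^ 2 ∂P ≤ γ ^ 2 * (n * σ ^ 2) := by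
    gcongr
    refine (Finset.sum_le_sum fun i _ => (S.memLp_noise γ X₀ t i).2).trans ?_
    simp
  simp only [integral_const, probReal_univ, one_smul] at hint
  refine hint.trans ?_
  rw [add_mul, div_eq_mul_one_div (1 - p + p * ρ) α]
  linarith

end Assumptions

end OneStep

/-! ### Summation over the iterations -/

theorem sum_le_of_affine_recursion {e : ℕ → ℝ} {r c : ℝ} (he : ∀ t, 0 ≤ e t)
    (h : ∀ t, e (t + 1) ≤ r * e t + c) (T : ℕ) :
    (1 - r) * ∑ t ∈ Finset.range T, e t ≤ e 0 + T * c := by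
  -- Keeping the last term `e T` is what lets the induction close.
  suffices h' : (1 - r) * ∑ t ∈ Finset.range T, e t + e T ≤ e 0 + T * c by
    linarith [he T]
  induction T with
  | zero => simp
  | succ T ih =>
    rw [Finset.sum_range_succ]
    push_cast
    linarith [h T]

/-- The condition on `k` bounds the second summand by `(1 - s) / 6`. After clearing denominators,
what is left is `0 ≤ (1 - s) * (10 + 29 * s - 21 * s ^ 2)`. -/
theorem contraction_factor_le {s k : ℝ} (hs0 : 0 ≤ s) (hs1 : s < 1)
    (hk : 24 * k ≤ (1 - s) ^ 2) :
    s ^ 2 / ((5 + 7 * s) / 12) + k / ((1 - s) / 4) ≤ (1 + s ^ 2) / 2 := by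
  have h1 : 0 < 1 - s := by linarith
  have h2 : k / ((1 - s) / 4) ≤ (1 - s) / 6 := by
    rw [div_le_iff₀ (by positivity)]
    linarith
  have h3 : s ^ 2 / ((5 + 7 * s) / 12) ≤ (1 + s ^ 2) / 2 - (1 - s) / 6 := by
    rw [div_le_iff₀ (by positivity)]
    have h4 : 0 ≤ (1 - s) * (10 + 29 * s - 21 * s ^ 2) := by
      have : s ^ 2 ≤ 1 := pow_le_one₀ hs0 hs1.le
      exact mul_nonneg h1.le (by nlinarith)
    linarith
  linarith

/-- Summing the recursion costs a factor `2 * A` with `A = 1 / (1 - s ^ 2)`. With `B = 1 / (1 - s)`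
one has `A ≤ B`, `1 ≤ B` and `D₁ = 2 * B ^ 2`, which absorbs the heterogeneity and noise terms; `A ≤
D₂` handles the initial error. -/
theorem sum_consensus_le {e : ℕ → ℝ} {s n σ ζ γ D₁ D₂ : ℝ} (T : ℕ) (he : ∀ t, 0 ≤ e t)
    (hs0 : 0 ≤ s) (hs1 : s < 1) (hn : 0 < n) (hσ : 0 < σ)
    (hstep : ∀ t, e (t + 1) ≤ (1 + s ^ 2) / 2 * e t
      + (γ ^ 2 * (n * ζ ^ 2) / ((1 - s) / 3) + γ ^ 2 * (n * σ ^ 2)))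
    (hγ : γ ^ 2 * T ≤ n / σ ^ 2) (hD₁ : D₁ = 2 / (1 - s) ^ 2) (hD₂ : 1 / (1 - s ^ 2) ≤ D₂) :
    ∑ t ∈ Finset.range T, e t ≤ 2 * D₁ * n ^ 2 + 3 * D₁ * n ^ 2 * ζ ^ 2 / σ ^ 2
      + 2 * D₂ * e 0 := by
  have h1 : 0 < 1 - s := by linarith
  have h2 : 0 < 1 - s ^ 2 := by nlinarith
  have hsum := sum_le_of_affine_recursion he hstep T
  set tot := ∑ t ∈ Finset.range T, e t
  set A := 1 / (1 - s ^ 2) with hA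
  set B := 1 / (1 - s) with hB
  have hAB : A ≤ B := by
    rw [hA, hB]
    exact one_div_le_one_div_of_le h1 (by nlinarith)
  have hA0 : 0 < A := by positivity
  have hB1 : 1 ≤ B := by
    rw [hB, le_div_iff₀ h1]
    linarith
  have hDB : D₁ = 2 * B ^ 2 := by
    rw [hD₁, hB]
    field_simp
  have hx : (T : ℝ) * (γ ^ 2 * (n * ζ ^ 2) / ((1 - s) / 3) + γ ^ 2 * (n * σ ^ 2))
      = (γ ^ 2 * T) * (n * (3 * ζ ^ 2 * B + σ ^ 2)) := by
    rw [hB]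
    field_simp
  have hy : (γ ^ 2 * T) * (n * (3 * ζ ^ 2 * B + σ ^ 2))
      ≤ n / σ ^ 2 * (n * (3 * ζ ^ 2 * B + σ ^ 2)) := by
    gcongr
  have hz : n / σ ^ 2 * (n * (3 * ζ ^ 2 * B + σ ^ 2))
      = 3 * B * (n ^ 2 * ζ ^ 2 / σ ^ 2) + n ^ 2 := by
    field_simp
  set Z := n ^ 2 * ζ ^ 2 / σ ^ 2 with hZ
  have hZ0 : 0 ≤ Z := by positivity
  have hmain : tot ≤ 2 * A * (e 0 + (3 * B * Z + n ^ 2)) := by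
    have h3 : (1 - s ^ 2) / 2 * tot ≤ e 0 + (3 * B * Z + n ^ 2) := by linarith
    calc tot = 2 * A * ((1 - s ^ 2) / 2 * tot) := by
          rw [hA]
          field_simp
      _ ≤ _ := mul_le_mul_of_nonneg_left h3 (by positivity)
  have e1 : A * e 0 ≤ D₂ * e 0 := mul_le_mul_of_nonneg_right hD₂ (he 0)
  have e2 : A * (B * Z) ≤ B * (B * Z) := mul_le_mul_of_nonneg_right hAB (by positivity)
  have e3 : A * n ^ 2 ≤ B ^ 2 * n ^ 2 := by
    refine mul_le_mul_of_nonneg_right (hAB.trans ?_) (by positivity)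
    nlinarith
  have e4 : 3 * D₁ * n ^ 2 * ζ ^ 2 / σ ^ 2 = 6 * (B * (B * Z)) := by
    rw [hDB, hZ]
    ring
  have e5 : 0 ≤ B ^ 2 * n ^ 2 := by positivity
  rw [e4, hDB]
  linarith

/-- Telescoping over times below `T` leaves `2 / γ * (φ 0 - φ T)`, and the bound on `A T` adds `2 /
γ * (φ T - c)`; the two values `φ T` cancel. -/
theorem sum_gradient_le {A φ e : ℕ → ℝ} {γ c k r : ℝ} (hγ : 0 < γ) (hA0 : ∀ t, 0 ≤ A t)
    (hA : ∀ t, A t ≤ 2 / γ * (φ t - c))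
    (hdesc : ∀ t, γ / 2 * A t ≤ φ t - φ (t + 1) + γ / 2 * (k * e t) + γ / 2 * r) (T : ℕ) :
    ∑ t ∈ Finset.Icc 1 T, A t ≤ 2 / γ * (φ 0 - c) + k * ∑ t ∈ Finset.range T, e t + T * r := by
  have h1 : ∀ T : ℕ, ∑ t ∈ Finset.range T, A t
      ≤ 2 / γ * (φ 0 - φ T) + k * ∑ t ∈ Finset.range T, e t + T * r := by
    intro T
    induction T with
    | zero => simp
    | succ T ih =>
      rw [Finset.sum_range_succ, Finset.sum_range_succ]
      have h := mul_le_mul_of_nonneg_left (hdesc T) (by positivity : 0 ≤ 2 / γ)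
      have e1 : 2 / γ * (γ / 2 * A T) = A T := by field_simp
      have e2 : 2 / γ * (φ T - φ (T + 1) + γ / 2 * (k * e T) + γ / 2 * r)
          = 2 / γ * (φ T - φ (T + 1)) + k * e T + r := by field_simp
      rw [e1, e2] at h
      push_cast
      linarith
  have h2 : ∑ t ∈ Finset.Icc 1 T, A t ≤ ∑ t ∈ Finset.range (T + 1), A t := by
    refine Finset.sum_le_sum_of_subset_of_nonneg (fun t ht => ?_) fun t _ _ => hA0 t
    rw [Finset.mem_Icc] at ht
    exact Finset.mem_range.2 (by omega)
  rw [Finset.sum_range_succ] at h2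
  linarith [h1 T, hA T]

/-! ### Consequences of the step size choice -/

theorem rate_arithmetic {G E Δ e₀ L σ ζ γ D₁ D₂ n T : ℝ} (hn : 0 < n) (hT : 0 < T) (hσ : 0 < σ)
    (hL : 0 ≤ L) (hΔ : 0 ≤ Δ)
    (hγ : γ = 1 / (2 * √(3 * D₁) * L + σ / √n * √T))
    (hG : G ≤ 2 / γ * Δ + L ^ 2 / n * E + T * (L * γ * σ ^ 2 / n))
    (hE : E ≤ 2 * D₁ * n ^ 2 + 3 * D₁ * n ^ 2 * ζ ^ 2 / σ ^ 2 + 2 * D₂ * e₀) :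
    1 / T * G ≤ (6 * σ * Δ + 3 * L * σ) / (2 * √(n * T))
        + (6 * √3 * √D₁ * L * Δ + 2 * L ^ 2 * D₁ * n) / T
        + 3 * L ^ 2 * D₁ * n * ζ ^ 2 / (σ ^ 2 * T) + 2 * L ^ 2 * D₂ * e₀ / (n * T) := by
  have ha : 0 < √n := Real.sqrt_pos.2 hn
  have hb : 0 < √T := Real.sqrt_pos.2 hT
  have han : n = √n ^ 2 := (Real.sq_sqrt hn.le).symm
  have hbT : T = √T ^ 2 := (Real.sq_sqrt hT.le).symm
  have hden : 0 < 2 * √(3 * D₁) * L + σ / √n * √T := by positivity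
  rw [Real.sqrt_mul (by norm_num : (0 : ℝ) ≤ 3)] at hγ hden
  rw [Real.sqrt_mul hn.le]
  have h1 : 2 / γ * Δ = 2 * (2 * (√3 * √D₁) * L + σ / √n * √T) * Δ := by
    rw [hγ]
    field_simp
  have h2 : γ ≤ √n / (σ * √T) := by
    rw [hγ, div_le_div_iff₀ hden (by positivity)]
    have h3 : √n * (2 * (√3 * √D₁) * L + σ / √n * √T)
        = 2 * (√3 * √D₁) * L * √n + σ * √T := by field_simp
    rw [h3, one_mul]
    have : 0 ≤ 2 * (√3 * √D₁) * L * √n := by positivity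
    linarith
  have h3 : L * γ * σ ^ 2 / n ≤ L * σ / (√n * √T) := by
    calc L * γ * σ ^ 2 / n ≤ L * (√n / (σ * √T)) * σ ^ 2 / n := by gcongr
      _ = L * (√n / (σ * √T)) * σ ^ 2 / √n ^ 2 := by rw [← han]
      _ = L * σ / (√n * √T) := by field_simp
  have h4 : L ^ 2 / n * E
      ≤ L ^ 2 / n * (2 * D₁ * n ^ 2 + 3 * D₁ * n ^ 2 * ζ ^ 2 / σ ^ 2 + 2 * D₂ * e₀) := by gcongr
  have h5 : 1 / T * G ≤ 1 / T * (2 * (2 * (√3 * √D₁) * L + σ / √n * √T) * Δ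
      + L ^ 2 / n * (2 * D₁ * n ^ 2 + 3 * D₁ * n ^ 2 * ζ ^ 2 / σ ^ 2 + 2 * D₂ * e₀)
      + T * (L * σ / (√n * √T))) := by
    gcongr
    rw [← h1]
    exact hG.trans (add_le_add (add_le_add le_rfl h4) (mul_le_mul_of_nonneg_left h3 hT.le))
  have h6 : 1 / T * (σ / √n * √T) = σ / (√n * √T) := by
    rw [show 1 / T = 1 / √T ^ 2 by rw [← hbT]]
    field_simp
  have h7 : 1 / T * (2 * (2 * (√3 * √D₁) * L + σ / √n * √T) * Δ
      + L ^ 2 / n * (2 * D₁ * n ^ 2 + 3 * D₁ * n ^ 2 * ζ ^ 2 / σ ^ 2 + 2 * D₂ * e₀)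
      + T * (L * σ / (√n * √T)))
      = 4 * (√3 * √D₁ * L * Δ / T) + 2 * Δ * (1 / T * (σ / √n * √T))
        + 2 * L ^ 2 * D₁ * n / T + 3 * L ^ 2 * D₁ * n * ζ ^ 2 / (σ ^ 2 * T)
        + 2 * L ^ 2 * D₂ * e₀ / (n * T) + L * σ / (√n * √T) := by
    generalize √n = a at *
    generalize √T = b at *
    field_simp
    ring
  rw [h6] at h7
  have h8 : (6 * σ * Δ + 3 * L * σ) / (2 * (√n * √T))
      = 3 * Δ * (σ / (√n * √T)) + 3 / 2 * (L * σ / (√n * √T)) := by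
    field_simp
    ring
  have h9 : (6 * √3 * √D₁ * L * Δ + 2 * L ^ 2 * D₁ * n) / T
      = 6 * (√3 * √D₁ * L * Δ / T) + 2 * L ^ 2 * D₁ * n / T := by ring
  rw [h8, h9]
  -- The argument produces the coefficients `4`, `2` and `1` where the claim allows `6`, `3` and `3
  -- / 2`; the slack is nonnegative.
  have p1 : 0 ≤ √3 * √D₁ * L * Δ / T := by positivity
  have p2 : 0 ≤ Δ * (σ / (√n * √T)) := by positivity
  have p3 : 0 ≤ L * σ / (√n * √T) := by positivity
  linarith

/-- Both summands of `1 / γ` are nonnegative, so each times `γ` is at most `1`. Squaring the first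
controls `L * γ` against the spectral gap, and squaring the second controls `γ ^ 2 * T`. -/
theorem step_size_bounds {L σ γ D₁ s n T : ℝ} (hn : 0 < n) (hT : 0 < T) (hσ : 0 < σ)
    (hL : 0 ≤ L) (hs0 : 0 ≤ s) (hs1 : s < 1) (hD₁ : D₁ = 2 / (1 - s) ^ 2)
    (hγ : γ = 1 / (2 * √(3 * D₁) * L + σ / √n * √T)) :
    0 < γ ∧ 12 * D₁ * L ^ 2 * γ ^ 2 ≤ 1 ∧ γ ^ 2 * T ≤ n / σ ^ 2 ∧ L * γ ≤ 1 ∧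
      24 * (γ ^ 2 * L ^ 2) ≤ (1 - s) ^ 2 := by
  have h1 : 0 < 1 - s := by linarith
  have hD0 : 2 ≤ D₁ := by
    rw [hD₁, le_div_iff₀ (by positivity)]
    nlinarith
  have hx : 0 ≤ 2 * √(3 * D₁) * L := by positivity
  have ha : 0 < √n := Real.sqrt_pos.2 hn
  have hb : 0 < √T := Real.sqrt_pos.2 hT
  have hy : 0 < σ / √n * √T := by positivity
  have hγ0 : 0 < γ := by
    rw [hγ]
    positivity
  have hprod : γ * (2 * √(3 * D₁) * L) + γ * (σ / √n * √T) = 1 := by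
    rw [← mul_add, hγ]
    exact one_div_mul_cancel (by positivity)
  have q1 : γ * (2 * √(3 * D₁) * L) ≤ 1 := by
    have := mul_pos hγ0 hy
    linarith
  have q2 : γ * (σ / √n * √T) ≤ 1 := by
    have := mul_nonneg hγ0.le hx
    linarith
  have r1 : 12 * D₁ * L ^ 2 * γ ^ 2 ≤ 1 := by
    have h := pow_le_one₀ (n := 2) (by positivity) q1
    have h2 : (γ * (2 * √(3 * D₁) * L)) ^ 2 = 4 * (√(3 * D₁)) ^ 2 * L ^ 2 * γ ^ 2 := by ring
    rw [h2, Real.sq_sqrt (by positivity)] at h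
    linarith
  have r2 : γ ^ 2 * T ≤ n / σ ^ 2 := by
    have h := pow_le_one₀ (n := 2) (by positivity) q2
    have h2 : (γ * (σ / √n * √T)) ^ 2 = γ ^ 2 * (√T) ^ 2 * σ ^ 2 / (√n) ^ 2 := by
      field_simp
    rw [h2, Real.sq_sqrt hT.le, Real.sq_sqrt hn.le, div_le_one hn] at h
    rwa [le_div_iff₀ (by positivity)]
  refine ⟨hγ0, r1, r2, ?_, ?_⟩
  · have h : (L * γ) ^ 2 ≤ 1 := by nlinarith [sq_nonneg (L * γ)]
    exact (sq_le_one_iff₀ (by positivity)).1 h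
  · have h : 24 * (γ ^ 2 * L ^ 2) = 12 * D₁ * L ^ 2 * γ ^ 2 * (1 - s) ^ 2 := by
      rw [hD₁]
      field_simp
      ring
    rw [h]
    exact mul_le_of_le_one_left (sq_nonneg _) r1

end SAPS

/-! ### The convergence rate -/

theorem mainTheorem1
    -- `n` workers, models with `N` parameters, `T` iterations
    (N n T : ℕ) (hn : 2 ≤ n) (hT : 1 ≤ T)
    -- data distributions and loss functions of the workers
    {Ξ : Fin n → Type*} [∀ i, MeasurableSpace (Ξ i)]
    (D : ∀ i, Measure (Ξ i)) [∀ i, IsProbabilityMeasure (D i)]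
    (F : ∀ i, EuclideanSpace ℝ (Fin N) → Ξ i → ℝ)
    (hF_int : ∀ i x, Integrable (F i x) (D i))
    (hF_diff : ∀ i x, ∀ᵐ z ∂(D i), DifferentiableAt ℝ (fun y => F i y z) x)
    (hF_meas : ∀ i, Measurable fun a : EuclideanSpace ℝ (Fin N) × Ξ i =>
      SAPS.lossGradient F i a.1 a.2)
    -- the local objectives have `L`-Lipschitz gradients
    (L : ℝ) (hL : 0 ≤ L)
    (hf_diff : ∀ i, Differentiable ℝ (SAPS.localObjective D F i))
    (hf_lip : ∀ i x y, ‖gradient (SAPS.localObjective D F i) x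
      - gradient (SAPS.localObjective D F i) y‖ ≤ L * ‖x - y‖)
    -- stochastic gradients are unbiased, with variance at most `σ ^ 2`
    (σ ζ : ℝ) (hσ : 0 < σ) (hζ : 0 ≤ ζ)
    (h_unbiased : ∀ i x, Integrable (SAPS.lossGradient F i x) (D i) ∧
      ∫ z, SAPS.lossGradient F i x z ∂(D i) = gradient (SAPS.localObjective D F i) x)
    (h_var : ∀ i x,
      Integrable (fun z => ‖SAPS.lossGradient F i x z
        - gradient (SAPS.localObjective D F i) x‖ ^ 2) (D i) ∧
      ∫ z, ‖SAPS.lossGradient F i x z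
        - gradient (SAPS.localObjective D F i) x‖ ^ 2 ∂(D i) ≤ σ ^ 2)
    -- the local gradients deviate from the global gradient by at most `ζ ^ 2` in mean square
    (h_dev : ∀ x, (1 / (n : ℝ)) * ∑ i, ‖gradient (SAPS.localObjective D F i) x
      - gradient (SAPS.objective D F) x‖ ^ 2 ≤ ζ ^ 2)
    -- the optimal value
    (fstar : ℝ) (hfstar : IsGLB (Set.range (SAPS.objective D F)) fstar)
    -- the random inputs: gossip matrices, mask bits, samples; all mutually independent
    {Ω : Type*} [MeasurableSpace Ω] (P : Measure Ω) [IsProbabilityMeasure P]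
    (W : ℕ → Ω → Matrix (Fin n) (Fin n) ℝ) (m : ℕ → Fin N → Ω → Bool)
    (ξ : ℕ → ∀ i, Ω → Ξ i)
    (hW_meas : ∀ t, Measurable (W t)) (hm_meas : ∀ t j, Measurable (m t j))
    (hξ_meas : ∀ t i, Measurable (ξ t i))
    (h_indep : iIndep (SAPS.sourceAlgebra W m ξ) P)
    (hξ_law : ∀ t i, P.map (ξ t i) = D i)
    -- masks are Bernoulli with parameter `p = 1 / c`, where `c` is the compression ratio
    (c p q : ℝ) (hc : 1 ≤ c) (hp : p = 1 / c) (hq : q = 1 - 1 / c)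
    (hm_law : ∀ t j, P {ω | m t j ω = true} = ENNReal.ofReal p)
    -- gossip matrices are identically distributed and doubly stochastic, with `ρ < 1`
    (hW_ident : ∀ t, IdentDistrib (W t) (W 0) P P)
    (hW_ds : ∀ t, ∀ᵐ ω ∂P, W t ω ∈ doublyStochastic ℝ (Fin n))
    (ρ : ℝ)
    (hρ : ∀ t, SAPS.secondLargestEigenvalue hn
      (SAPS.gossipSecondMoment_isHermitian P (W t)) = ρ)
    (hρ1 : ρ < 1)
    -- the constants, the step size and the initial models
    (D₁ D₂ γ : ℝ)
    (hD₁ : D₁ = 2 / (1 - √(q + p * ρ)) ^ 2)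
    (hD₂ : D₂ = 2 / (1 - (q + p * ρ ^ 2)))
    (hγ : γ = 1 / (2 * √(3 * D₁) * L + σ / √(n : ℝ) * √(T : ℝ)))
    (X₀ : Matrix (Fin N) (Fin n) ℝ) :
    0 < γ ∧ 0 < 1 - 3 * D₁ * L ^ 2 * γ ^ 2 ∧
    (∀ t, Integrable (fun ω => ‖gradient (SAPS.objective D F)
      (SAPS.average (SAPS.iterates F γ X₀ W m ξ t ω))‖ ^ 2) P) ∧
    (1 / (T : ℝ)) * ∑ t ∈ Finset.Icc 1 T, ∫ ω, ‖gradient (SAPS.objective D F)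
        (SAPS.average (SAPS.iterates F γ X₀ W m ξ t ω))‖ ^ 2 ∂P
      ≤ (6 * σ * (SAPS.objective D F (SAPS.average X₀) - fstar) + 3 * L * σ)
            / (2 * √((n : ℝ) * (T : ℝ)))
        + (6 * √3 * √D₁ * L * (SAPS.objective D F (SAPS.average X₀) - fstar)
            + 2 * L ^ 2 * D₁ * n) / T
        + 3 * L ^ 2 * D₁ * n * ζ ^ 2 / (σ ^ 2 * T)
        + 2 * L ^ 2 * D₂ * SAPS.consensusErrorSq X₀ / (n * T) := by
  -- parameters
  have hn0 : (0 : ℝ) < n := by exact_mod_cast (by omega : 0 < n)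
  have hT0 : (0 : ℝ) < T := by exact_mod_cast hT
  have hp0 : 0 < p := by rw [hp]; positivity
  have hp1 : p ≤ 1 := by rw [hp]; exact (div_le_one (by linarith)).2 hc
  have hqp : q = 1 - p := by rw [hq, hp]
  have hρ0 : 0 ≤ ρ := by
    rw [← hρ 0]
    exact SAPS.secondLargestEigenvalue_nonneg hn _
      (SAPS.dotProduct_gossipSecondMoment_nonneg (hW_meas 0) (hW_ds 0))
  set s := √(q + p * ρ) with hs
  have hss : s ^ 2 = 1 - p + p * ρ := by
    rw [hs, Real.sq_sqrt (by rw [hqp]; nlinarith), hqp]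
  have hs0 : 0 ≤ s := Real.sqrt_nonneg _
  have hgap : 0 < p * (1 - ρ) := mul_pos hp0 (by linarith)
  have hs1 : s < 1 := by
    have : s ^ 2 < 1 := by rw [hss]; linarith
    exact (sq_lt_one_iff₀ hs0).1 this
  -- The contraction has `ρ` where `D₂` has `ρ ^ 2`; the numerator `2` of `D₂` makes up for the
  -- factor `1 + ρ ≤ 2`.
  have hD₂' : 1 / (1 - s ^ 2) ≤ D₂ := by
    have h1 : 1 - s ^ 2 = p * (1 - ρ) := by rw [hss]; ring
    have h2 : 1 - (q + p * ρ ^ 2) = p * (1 - ρ) * (1 + ρ) := by rw [hqp]; ring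
    rw [hD₂, h1, h2, div_le_div_iff₀ hgap (by positivity)]
    nlinarith
  obtain ⟨hγ0, hγD, hγT, hLγ, hγL⟩ :=
    SAPS.step_size_bounds hn0 hT0 hσ hL hs0 hs1 hD₁ hγ
  have S : SAPS.Assumptions hn D F L σ ζ fstar P W m ξ p ρ :=
    { measurable_lossGradient := hF_meas
      lipschitz_nonneg := hL
      differentiable := hf_diff
      lipschitz := hf_lip
      unbiased := h_unbiased
      variance_le := h_var
      deviation_le := h_dev
      lower_bound := fun x => hfstar.1 (Set.mem_range_self x)
      measurable_W := hW_meas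
      measurable_m := hm_meas
      measurable_ξ := hξ_meas
      indep := h_indep
      law_ξ := hξ_law
      p_nonneg := hp0.le
      law_m := hm_law
      doublyStochastic_W := hW_ds
      eigenvalue := hρ
      eigenvalue_lt := hρ1 }
  have hgrad := fun t => SAPS.memLp_integrable_sq_norm (S.memLp_gradient_average γ X₀ t)
  refine ⟨hγ0, by linarith, hgrad, ?_⟩
  set A : ℕ → ℝ := fun t => ∫ ω, ‖gradient (SAPS.objective D F)
    (SAPS.average (SAPS.iterates F γ X₀ W m ξ t ω))‖ ^ 2 ∂P with hA
  set φ : ℕ → ℝ := fun t => ∫ ω, SAPS.objective D F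
    (SAPS.average (SAPS.iterates F γ X₀ W m ξ t ω)) ∂P with hφ
  set e : ℕ → ℝ := fun t => ∫ ω, SAPS.consensusErrorSq (SAPS.iterates F γ X₀ W m ξ t ω) ∂P with he
  have hφ0 : φ 0 = SAPS.objective D F (SAPS.average X₀) := by simp [hφ, SAPS.iterates]
  have he0 : e 0 = SAPS.consensusErrorSq X₀ := by simp [he, SAPS.iterates]
  have he_nonneg : ∀ t, 0 ≤ e t := fun t => integral_nonneg fun ω =>
    Finset.sum_nonneg fun j _ => Finset.sum_nonneg fun i _ => sq_nonneg _
  -- consensus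
  have hcons : ∀ t, e (t + 1) ≤ (1 + s ^ 2) / 2 * e t
      + (γ ^ 2 * (n * ζ ^ 2) / ((1 - s) / 3) + γ ^ 2 * (n * σ ^ 2)) := by
    intro t
    -- The weights given to the two drifts are proportional to the gap `1 - s`; `α` is what remains
    -- of `1`. The value of `κ` turns the heterogeneity term into exactly the one allowed by `D₁`.
    have h1 := S.consensus_step γ X₀ t (α := (5 + 7 * s) / 12) (β := (1 - s) / 4)
      (κ := (1 - s) / 3) (by positivity) (by linarith) (by linarith) (by ring)
    rw [← hss] at h1
    have h2 := mul_le_mul_of_nonneg_right (SAPS.contraction_factor_le hs0 hs1 hγL) (he_nonneg t)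
    rw [← add_assoc]
    exact h1.trans (add_le_add (add_le_add h2 le_rfl) le_rfl)
  have hE := SAPS.sum_consensus_le T he_nonneg hs0 hs1 hn0 hσ hcons hγT hD₁ hD₂'
  -- descent
  have hA_le : ∀ t, A t ≤ 2 / γ * (φ t - fstar) := by
    intro t
    have h1 := S.integrable_objective γ X₀ t
    calc A t ≤ ∫ ω, 2 / γ * (SAPS.objective D F
          (SAPS.average (SAPS.iterates F γ X₀ W m ξ t ω)) - fstar) ∂P :=
        integral_mono (hgrad t) ((h1.sub (integrable_const _)).const_mul _) fun ω =>
          SAPS.sq_norm_gradient_le (SAPS.differentiable_objective S.differentiable)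
            S.objective_lipschitz hγ0 hLγ S.lower_bound _
      _ = _ := by
        rw [integral_const_mul, integral_sub h1 (integrable_const _)]
        simp [hφ]
  have hdesc : ∀ t, γ / 2 * A t ≤ φ t - φ (t + 1) + γ / 2 * (L ^ 2 / n * e t)
      + γ / 2 * (L * γ * σ ^ 2 / n) := by
    intro t
    refine (S.descent hγ0 hLγ X₀ t).trans (le_of_eq ?_)
    simp only [hφ, he]
    ring
  have hG := SAPS.sum_gradient_le hγ0 (fun t => integral_nonneg fun ω => sq_nonneg _)
    hA_le hdesc T
  rw [hφ0] at hG
  rw [he0] at hE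
  exact SAPS.rate_arithmetic hn0 hT0 hσ hL
    (sub_nonneg.2 (S.lower_bound _)) hγ hG hE
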